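/- **Global Caccioppoli inequality.** Let $d\in\mathbb N$, $\lambda\in(1,\infty)$, let $U\subseteq B_1=\{x\in\mathbb R^d:|x|<1\}$ be a bounded Lipschitz domain (open, connected, nonempty, and near each boundary point the region above the graph of a Lipschitz function in suitable orthonormal coordinates), let $I=(I_-,I_+)\subseteq(0,1/4)$ be a nonempty open interval, and put $V=U\times I$. For $r>0$ let $B_r=\{x\in\mathbb R^d:|x|<r\}$, $I_r=(0,r^2]$ and $Q_r=B_r\times I_r$. For open $W\subseteq\mathbb R^d$ let $\|f\|_{H^1(W)}=(\|f\|_{L^2(W)}^2+\|\nabla f\|_{L^2(W)}^2)^{1/2}$, let $H^1_0(W)$ be the closure of $C_c^\infty(W)$ in $H^1(W)$, and let $H^{-1}(W)$ be the dual of $H_0^1(W)$, with norm $\sup\{\langle F,g\rangle: g\in H^1_0(W),\ \|g\|_{H^1(W)}\le 1\}$. For $W\subseteq U$, an element of $H^{-1}(U)$ is restricted to $W$ by means of the extension by zero $H^1_0(W)\subseteq H^1_0(U)$. $L^2(X;J)$ denotes the square integrable maps $J\to X$. Let $$H^1_{\mathrm{par}}(V)=\{f\in L^2(H^1(U);I):\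 \partial_t f\in L^2(H^{-1}(U);I)\},\qquad \|f\|_{H^1_{\mathrm{par}}(V)}=\|f\|_{L^2(H^1(U);I)}+\|\partial_tf\|_{L^2(H^{-1}(U);I)},$$ and let $H^1_{\mathrm{par},\sqcup}(V)$ be the closure in $H^1_{\mathrm{par}}(V)$ of the set of restrictions to $V$ of functions in $C_c^\infty(U\times(I_-,\infty))$, that is, of smooth functions vanishing near the parabolic boundary $\partial_\sqcup V=(\partial U\times I)\cup(U\times\{I_-\})$. Then there is a constant $C=C(V,d,\lambda)\in(0,\infty)$ with the following property. Let $\Lambda\in(0,\infty)$ and let $\mathbf a,\mathbf b,\mathbf d$ be measurable functions on $\mathbb R^d\times\mathbb R$ with values in the symmetric $d\times d$ matrices, in $\mathbb R^d$ and in $\mathbb R$ respectively, such that, almost everywhere, $|\xi|^2\le\xi\cdot\mathbf a\xi\le\lambda|\xi|^2$ for all $\xi\in\mathbb R^d$ and $\mathbf d\le0$, and such that $\|\mathbf b\|_{L^\infty}^2\le\Lambda$ and $\|\mathbf d\|_{L^\infty}^2\le\Lambda$. Let $H\in L^2(H^{-1}(U);I)$ and let $v\in H^1_{\mathrm{par},\sqcup}(V)$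 be a weak solution of $$\partial_t v-\nabla\cdot(\mathbf a\nabla v)-\mathbf b\cdot\nabla v-\mathbf d v+\Lambda v=H\ \text{ in }V,\qquad v=0\ \text{ on }\partial_\sqcup V,$$ that is, for all $\eta\in L^2(H^1_0(U);I)$, $$\int_I\langle\partial_t v,\eta\rangle\,dt+\int_V\bigl(\nabla\eta\cdot\mathbf a\nabla v-\eta\,\mathbf b\cdot\nabla v-\mathbf d v\eta+\Lambda v\eta\bigr)\,dx\,dt=\int_I\langle H,\eta\rangle\,dt .$$ Then for every $r>0$ $$\|\nabla v\|_{L^2(Q_r\cap V)}\le C\left(r^{-1}\|v\|_{L^2(Q_{2r}\cap V)}+\|H\|_{L^2(H^{-1}(B_{2r}\cap U);\,I_{2r}\cap I)}\right).$$ -/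

import Mathlib

open Set MeasureTheory Topology
open scoped ENNReal NNReal ContDiff

noncomputable section

namespace ParabolicCaccioppoli

/-- `ℝ^d` with the Euclidean norm. Space-time is `E d × ℝ`. -/
abbrev E (d : ℕ) : Type := EuclideanSpace ℝ (Fin d)

variable {d : ℕ}

/-! ### Geometry -/

/-- A bounded Lipschitz domain: a bounded, connected, nonempty open set which, near each of its
boundary points, is the region strictly above the graph of a Lipschitz function, in an orthonormal
coordinate system whose last axis is `n`. The graph function is evaluated at the component of `y`
orthogonal to `n`. -/
structure IsBoundedLipschitzDomain (U : Set (E d)) : Prop where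
  isOpen : IsOpen U
  isConnected : IsConnected U
  isBounded : Bornology.IsBounded U
  lipschitz_boundary : ∀ x ∈ frontier U, ∃ ρ > (0 : ℝ), ∃ n : E d, ‖n‖ = 1 ∧
    ∃ (K : ℝ≥0) (γ : E d → ℝ), LipschitzWith K γ ∧
      U ∩ Metric.ball x ρ =
        {y | y ∈ Metric.ball x ρ ∧ γ (y - (inner ℝ n y) • n) < inner ℝ n y}

/-- The space-time cylinder `Q_r = B_r × (0, r²]`, where `B_r` is the open ball about `0`. -/
def Q (r : ℝ) : Set (E d × ℝ) := Metric.ball (0 : E d) r ×ˢ Ioc (0 : ℝ) (r ^ 2)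

/-! ### Test functions and Sobolev spaces -/

/-- `φ ∈ C_c^∞(W)`, as a function on the whole space vanishing off a compact subset of `W`. -/
def IsTest {X : Type*} [NormedAddCommGroup X] [NormedSpace ℝ X] (W : Set X) (φ : X → ℝ) : Prop :=
  ContDiff ℝ ∞ φ ∧ HasCompactSupport φ ∧ tsupport φ ⊆ W

/-- `L²(U) × L²(U; ℝ^d)` with the norm `(‖f‖² + ‖g‖²)^{1/2}`. -/
abbrev L2Pair (U : Set (E d)) : Type :=
  WithLp 2 (Lp ℝ 2 (volume.restrict U) × Lp (E d) 2 (volume.restrict U))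

/-- `g` is the weak gradient of `f` in `U`. -/
def IsWeakGradient (U : Set (E d)) (f : E d → ℝ) (g : E d → E d) : Prop :=
  ∀ φ : E d → ℝ, IsTest U φ → ∀ e : E d,
    ∫ x in U, f x * fderiv ℝ φ x e = -∫ x in U, inner ℝ (g x) e * φ x

theorem IsTest.memLp {W U : Set (E d)} {φ : E d → ℝ} (h : IsTest W φ) :
    MemLp φ 2 (volume.restrict U) :=
  (h.1.continuous.memLp_of_hasCompactSupport h.2.1).restrict U

theorem IsTest.memLp_fderiv {W U : Set (E d)} {φ : E d → ℝ} (h : IsTest W φ) (e : E d) :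
    MemLp (fun x => fderiv ℝ φ x e) 2 (volume.restrict U) := by
  have hc : Continuous (fun x => fderiv ℝ φ x e) :=
    (h.1.continuous_fderiv (by simp)).clm_apply continuous_const
  exact (hc.memLp_of_hasCompactSupport (h.2.1.fderiv_apply (𝕜 := ℝ) e)).restrict U

/-- The space of pairs `(f, ∇f)`, where `f ∈ L²(U)` and its weak gradient `∇f` is in
`L²(U; ℝ^d)`. -/
def H1Submodule (U : Set (E d)) : Submodule ℝ (L2Pair U) where
  carrier := {p | IsWeakGradient U p.fst p.snd}
  zero_mem' := by
    intro φ hφ e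
    have h1 : ∫ x in U, ((0 : L2Pair U).fst x) * fderiv ℝ φ x e = 0 := by
      refine integral_eq_zero_of_ae ?_
      filter_upwards [Lp.coeFn_zero ℝ 2 (volume.restrict U)] with x hx
      have h0 : (0 : L2Pair U).fst x = 0 := hx
      rw [h0, zero_mul, Pi.zero_apply]
    have h2 : ∫ x in U, inner ℝ ((0 : L2Pair U).snd x) e * φ x = 0 := by
      refine integral_eq_zero_of_ae ?_
      filter_upwards [Lp.coeFn_zero (E d) 2 (volume.restrict U)] with x hx
      have h0 : (0 : L2Pair U).snd x = 0 := hx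
      rw [h0, inner_zero_left, zero_mul, Pi.zero_apply]
    rw [h1, h2, neg_zero]
  add_mem' := by
    intro p q hp hq φ hφ e
    have h1 : ∫ x in U, ((p + q).fst x) * fderiv ℝ φ x e =
        (∫ x in U, p.fst x * fderiv ℝ φ x e) + ∫ x in U, q.fst x * fderiv ℝ φ x e := by
      refine Eq.trans (integral_congr_ae ?_)
        (integral_add ((Lp.memLp p.fst).integrable_mul (hφ.memLp_fderiv e))
          ((Lp.memLp q.fst).integrable_mul (hφ.memLp_fderiv e)))
      filter_upwards [Lp.coeFn_add p.fst q.fst] with x hx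
      have : (p + q).fst x = p.fst x + q.fst x := hx
      simp only [this, add_mul]
    have h2 : ∫ x in U, inner ℝ ((p + q).snd x) e * φ x =
        (∫ x in U, inner ℝ (p.snd x) e * φ x) + ∫ x in U, inner ℝ (q.snd x) e * φ x := by
      refine Eq.trans (integral_congr_ae ?_)
        (integral_add (((Lp.memLp p.snd).inner_const e).integrable_mul hφ.memLp)
          (((Lp.memLp q.snd).inner_const e).integrable_mul hφ.memLp))
      filter_upwards [Lp.coeFn_add p.snd q.snd] with x hx
      have : (p + q).snd x = p.snd x + q.snd x := hx
      simp only [this, inner_add_left, add_mul]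
    rw [h1, h2, hp φ hφ e, hq φ hφ e]
    ring
  smul_mem' := by
    intro c p hp φ hφ e
    have h1 : ∫ x in U, ((c • p).fst x) * fderiv ℝ φ x e =
        c * ∫ x in U, p.fst x * fderiv ℝ φ x e := by
      rw [← integral_const_mul]
      refine integral_congr_ae ?_
      filter_upwards [Lp.coeFn_smul c p.fst] with x hx
      have : (c • p).fst x = c * p.fst x := hx
      rw [this, mul_assoc]
    have h2 : ∫ x in U, inner ℝ ((c • p).snd x) e * φ x =
        c * ∫ x in U, inner ℝ (p.snd x) e * φ x := by
      rw [← integral_const_mul]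
      refine integral_congr_ae ?_
      filter_upwards [Lp.coeFn_smul c p.snd] with x hx
      have : (c • p).snd x = c • p.snd x := hx
      rw [this, real_inner_smul_left, mul_assoc]
    rw [h1, h2, hp φ hφ e]
    ring

/-- The Sobolev space `H¹(U)`, with the norm `(‖f‖² + ‖∇f‖²)^{1/2}`. -/
def H1 (U : Set (E d)) : Type := H1Submodule U

instance (U : Set (E d)) : NormedAddCommGroup (H1 U) :=
  inferInstanceAs (NormedAddCommGroup (H1Submodule U))

instance (U : Set (E d)) : InnerProductSpace ℝ (H1 U) :=
  inferInstanceAs (InnerProductSpace ℝ (H1Submodule U))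

/-- The function underlying an element of `H¹(U)`. -/
def fn {U : Set (E d)} (f : H1 U) : Lp ℝ 2 (volume.restrict U) := (Subtype.val f : L2Pair U).fst

/-- The weak gradient of an element of `H¹(U)`. -/
def grad {U : Set (E d)} (f : H1 U) : Lp (E d) 2 (volume.restrict U) := (Subtype.val f : L2Pair U).snd

/-- The element `f` of `H¹(U)` is the class of the smooth function `φ`. -/
def IsClassOf {U : Set (E d)} (f : H1 U) (φ : E d → ℝ) : Prop :=
  fn f =ᵐ[volume.restrict U] φ ∧ grad f =ᵐ[volume.restrict U] gradient φ

/-- The image of `C_c^∞(W)` in `H¹(U)`, for `W ⊆ U`. -/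
def testSubmodule (U W : Set (E d)) : Submodule ℝ (H1 U) where
  carrier := {f | ∃ φ, IsTest W φ ∧ IsClassOf f φ}
  zero_mem' := by
    refine ⟨fun _ => 0, ⟨contDiff_const, HasCompactSupport.zero, by simp [tsupport]⟩, ?_, ?_⟩
    · exact Lp.coeFn_zero ℝ 2 (volume.restrict U)
    · have : gradient (fun _ : E d => (0 : ℝ)) = 0 := by ext1 x; simp [gradient]
      rw [this]
      exact Lp.coeFn_zero (E d) 2 (volume.restrict U)
  add_mem' := by
    rintro f g ⟨φ, hφ, hf⟩ ⟨ψ, hψ, hg⟩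
    refine ⟨φ + ψ, ⟨hφ.1.add hψ.1, hφ.2.1.add hψ.2.1,
      (tsupport_add φ ψ).trans (union_subset hφ.2.2 hψ.2.2)⟩, ?_, ?_⟩
    · exact (Lp.coeFn_add (fn f) (fn g)).trans (hf.1.add hg.1)
    · have : gradient (φ + ψ) = gradient φ + gradient ψ := by
        ext1 x
        simp only [gradient, Pi.add_apply]
        rw [fderiv_add (hφ.1.differentiable (by simp) x) (hψ.1.differentiable (by simp) x),
          map_add]
      rw [this]
      exact (Lp.coeFn_add (grad f) (grad g)).trans (hf.2.add hg.2)
  smul_mem' := by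
    rintro c f ⟨φ, hφ, hf⟩
    refine ⟨c • φ, ⟨contDiff_const.smul hφ.1, hφ.2.1.smul_left (f := fun _ => c),
      (tsupport_smul_subset_right (fun _ => c) φ).trans hφ.2.2⟩, ?_, ?_⟩
    · exact (Lp.coeFn_smul c (fn f)).trans (hf.1.const_smul c)
    · have : gradient (c • φ) = c • gradient φ := by
        ext1 x
        simp only [gradient, Pi.smul_apply]
        rw [fderiv_const_smul (hφ.1.differentiable (by simp) x), map_smul]
      rw [this]
      exact (Lp.coeFn_smul c (grad f)).trans (hf.2.const_smul c)

/-- The closure of `C_c^∞(W)` in `H¹(U)`, for `W ⊆ U`. -/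
def H10Submodule (U W : Set (E d)) : Submodule ℝ (H1 U) := (testSubmodule U W).topologicalClosure

/-- `H¹₀(W)` for an open set `W ⊆ U`: the closure of `C_c^∞(W)` in the `H¹` norm. Its elements are
regarded as elements of `H¹(U)`, through extension by zero (an isometry). In particular
`H10 U U` is `H¹₀(U)`. -/
def H10 (U W : Set (E d)) : Type := H10Submodule U W

instance (U W : Set (E d)) : NormedAddCommGroup (H10 U W) :=
  inferInstanceAs (NormedAddCommGroup (H10Submodule U W))

instance (U W : Set (E d)) : InnerProductSpace ℝ (H10 U W) :=
  inferInstanceAs (InnerProductSpace ℝ (H10Submodule U W))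

/-- The inclusion `H¹₀(W) ⊆ H¹(U)`. -/
def toH1 {U W : Set (E d)} : H10 U W →L[ℝ] H1 U := (H10Submodule U W).subtypeL

/-- `H⁻¹(W)` for an open set `W ⊆ U`: the dual of `H¹₀(W)` with the dual (operator) norm, the
supremum of `⟨F, g⟩` over `g ∈ H¹₀(W)` with `‖g‖_{H¹} ≤ 1`. -/
abbrev HNeg (U W : Set (E d)) : Type := H10 U W →L[ℝ] ℝ

theorem H10Submodule_mono {U W : Set (E d)} (h : W ⊆ U) : H10Submodule U W ≤ H10Submodule U U :=
  Submodule.topologicalClosure_mono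
    (fun _ ⟨φ, hφ, hf⟩ => ⟨φ, ⟨hφ.1, hφ.2.1, hφ.2.2.trans h⟩, hf⟩)

/-- The inclusion `H¹₀(W) ⊆ H¹₀(U)`, for `W ⊆ U`. -/
def inclH10 {U W : Set (E d)} (h : W ⊆ U) : H10 U W →L[ℝ] H10 U U :=
  (toH1 (U := U) (W := W)).codRestrict (H10Submodule U U)
    (fun g => H10Submodule_mono h (Subtype.property g))

/-- The restriction to `W ⊆ U` of a functional `F ∈ H⁻¹(U)`. -/
def restrictNeg {U W : Set (E d)} (h : W ⊆ U) (F : HNeg U U) : HNeg U W := F.comp (inclH10 h)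

/-! ### Parabolic Sobolev spaces on `U × (T₀, T₁)`

A function of `(x, t)` in `L²(I; H¹(U))` is a square integrable map `t ↦ v t` into `H¹(U)`. -/

/-- The `L²(S)` norm of a function `(x, t) ↦ F t x` on a subset `S` of `U × ℝ`. -/
def spaceTimeNorm {X : Type*} [NormedAddCommGroup X] {U : Set (E d)} (S : Set (E d × ℝ))
    (F : ℝ → Lp X 2 (volume.restrict U)) : ℝ≥0∞ :=
  (∫⁻ t, ∫⁻ x in {x | (x, t) ∈ S}, ‖F t x‖ₑ ^ 2) ^ (1 / 2 : ℝ)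

/-- `v' = ∂_t v` in the sense of distributions on `(T₀, T₁)` with values in `H⁻¹(U)`, where
`L²(U)` is embedded into `H⁻¹(U)` by the `L²` pairing. -/
def IsTimeDeriv {U : Set (E d)} (T₀ T₁ : ℝ) (v : ℝ → H1 U) (v' : ℝ → HNeg U U) : Prop :=
  ∀ ψ : ℝ → ℝ, IsTest (Ioo T₀ T₁) ψ → ∀ w : H10 U U,
    ∫ t in Ioo T₀ T₁, ψ t * v' t w =
      -∫ t in Ioo T₀ T₁, deriv ψ t * ∫ x in U, fn (v t) x * fn (toH1 w) x

/-- `v ∈ H¹_par(U × (T₀, T₁))`, with `∂_t v = v'`: that is, `v ∈ L²(I; H¹(U))` and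
`v' ∈ L²(I; H⁻¹(U))`. -/
structure MemHPar {U : Set (E d)} (T₀ T₁ : ℝ) (v : ℝ → H1 U) (v' : ℝ → HNeg U U) : Prop where
  memLp : MemLp v 2 (volume.restrict (Ioo T₀ T₁))
  memLp_deriv : MemLp v' 2 (volume.restrict (Ioo T₀ T₁))
  isTimeDeriv : IsTimeDeriv T₀ T₁ v v'

/-- The norm `‖v‖_{L²(I; H¹(U))} + ‖∂_t v‖_{L²(I; H⁻¹(U))}` of `H¹_par`, where `v' = ∂_t v`. -/
def hParNorm {U : Set (E d)} (T₀ T₁ : ℝ) (v : ℝ → H1 U) (v' : ℝ → HNeg U U) : ℝ≥0∞ :=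
  eLpNorm v 2 (volume.restrict (Ioo T₀ T₁)) + eLpNorm v' 2 (volume.restrict (Ioo T₀ T₁))

/-- The map `u`, with time derivative `u'`, is the restriction to `U × (T₀, T₁)` of the smooth
function `φ`. -/
def IsSmoothMap {U : Set (E d)} (T₀ T₁ : ℝ) (φ : E d × ℝ → ℝ) (u : ℝ → H1 U)
    (u' : ℝ → HNeg U U) : Prop :=
  ∀ t ∈ Ioo T₀ T₁, IsClassOf (u t) (fun x => φ (x, t)) ∧
    ∀ w : H10 U U, u' t w = ∫ x in U, deriv (fun s => φ (x, s)) t * fn (toH1 w) x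

/-- `v ∈ H¹_{par,⊔}(U × (T₀, T₁))`, with `∂_t v = v'`: the closure in `H¹_par` of the smooth
functions that vanish near the parabolic boundary `(∂U × [T₀, T₁]) ∪ (U × {T₀})`. -/
structure MemHParZero {U : Set (E d)} (T₀ T₁ : ℝ) (v : ℝ → H1 U) (v' : ℝ → HNeg U U) :
    Prop where
  memHPar : MemHPar T₀ T₁ v v'
  mem_closure : ∀ ε > (0 : ℝ≥0∞), ∃ φ : E d × ℝ → ℝ, IsTest (U ×ˢ Ioi T₀) φ ∧
    ∃ (u : ℝ → H1 U) (u' : ℝ → HNeg U U), IsSmoothMap T₀ T₁ φ u u' ∧ MemHPar T₀ T₁ u u' ∧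
      hParNorm T₀ T₁ (v - u) (v' - u') < ε

/-! ### The equation -/

/-- The coefficient class: `a` is symmetric with `|ξ|² ≤ ξ·aξ ≤ lam |ξ|²`, `‖b‖²_{L^∞} ≤ Λ`,
`c ≤ 0` and `‖c‖²_{L^∞} ≤ Λ`, on the whole of `ℝ^d × ℝ`. -/
structure IsAdmissible (lam Λ : ℝ) (a : E d × ℝ → Matrix (Fin d) (Fin d) ℝ)
    (b : E d × ℝ → E d) (c : E d × ℝ → ℝ) : Prop where
  measurable_a : ∀ i j, Measurable (fun z => a z i j)
  measurable_b : Measurable b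
  measurable_c : Measurable c
  symm : ∀ᵐ z, (a z).IsSymm
  elliptic : ∀ᵐ z, ∀ ξ : E d, ‖ξ‖ ^ 2 ≤ inner ℝ ξ (Matrix.toEuclideanLin (a z) ξ) ∧
    inner ℝ ξ (Matrix.toEuclideanLin (a z) ξ) ≤ lam * ‖ξ‖ ^ 2
  bound_b : eLpNorm b ∞ volume ^ 2 ≤ ENNReal.ofReal Λ
  nonpos_c : ∀ᵐ z, c z ≤ 0
  bound_c : eLpNorm c ∞ volume ^ 2 ≤ ENNReal.ofReal Λ

/-- Weak formulation of `∂_t v - ∇·(a∇v) - b·∇v - c v + Λ v = H` in `U × (T₀, T₁)`, where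
`v' = ∂_t v`: the equation is tested with every `η ∈ L²((T₀, T₁); H¹₀(U))`. -/
def IsWeakSolution {U : Set (E d)} (T₀ T₁ Λ : ℝ) (a : E d × ℝ → Matrix (Fin d) (Fin d) ℝ)
    (b : E d × ℝ → E d) (c : E d × ℝ → ℝ) (H : ℝ → HNeg U U)
    (v : ℝ → H1 U) (v' : ℝ → HNeg U U) : Prop :=
  ∀ η : ℝ → H10 U U, MemLp η 2 (volume.restrict (Ioo T₀ T₁)) →
    ∫ t in Ioo T₀ T₁, (v' t (η t) + ∫ x in U,
      (inner ℝ (grad (toH1 (η t)) x) (Matrix.toEuclideanLin (a (x, t)) (grad (v t) x))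
        - fn (toH1 (η t)) x * inner ℝ (b (x, t)) (grad (v t) x)
        - c (x, t) * fn (v t) x * fn (toH1 (η t)) x
        + Λ * fn (v t) x * fn (toH1 (η t)) x)) =
    ∫ t in Ioo T₀ T₁, H t (η t)

end ParabolicCaccioppoli

end

/-!
The inequality is obtained by testing the equation with `η = (1 - t) χ² v` on `T₀ < t < s`, where
`s = min (r², T₁)` and `χ` is a spatial cutoff equal to `1` on `B_r`, supported in `B_{2r}`, with
gradient bounded by a multiple of `r⁻¹`. No cutoff in time is needed, because `v` vanishes at the
initial time and the boundary term at time `s` has the favourable sign.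

* The time derivative. For smooth functions vanishing near the parabolic boundary,
  `(1 - t) χ² φ ∂_t φ - χ² φ² / 2` is the time derivative of `(1 - t) χ² φ² / 2`, so that
  `∫ (1 - t) ⟨∂_t v, χ² v⟩ ≥ ½ ∫ ‖χ v‖²`. Both sides are continuous in the norm of `H¹_par`, and the
  inequality passes to the closure (`MemHParZero.energy`). The weight `1 - t` puts the `L²` norm of
  `χ v` on the good side; it controls the `L²` part of `‖χ² v‖_{H¹}` whatever the size of `r`, so
  that neither a Poincaré inequality nor the regularity of `∂U` enters.
* The elliptic part. By positivity of the diffusion form, and by absorbing the drift into `Λ v²`,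
  the form at a fixed time, tested with `χ² v`, is at least `¼ ‖χ ∇v‖² - 2 λ ‖v ∇χ‖²`
  (`pointwise_lower_bound`, `IsAdmissible.form_lower_bound`). As a function of time the form is
  measurable by a Carathéodory argument (`IsAdmissible.aestronglyMeasurable_form`), which makes the
  integrals in the weak formulation genuine ones.
* The right-hand side. `χ² v(t)` belongs to `H¹₀(B_{2r} ∩ U)` for almost every `t`
  (`MemHParZero.ae_mem`, `mulH1_mem_H10Submodule`), so only the restriction of `H` to `B_{2r} ∩ U`
  is seen, and `‖χ² v‖²_{H¹} ≤ ‖χ v‖² + 2 ‖χ ∇v‖² + 8 ‖v ∇χ‖²` is absorbed.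

The outcome is `IsWeakSolution.caccioppoli_cutoff`; the constant depends on `d` and `λ` only.
-/

open Set MeasureTheory Topology
open scoped ENNReal NNReal ContDiff

noncomputable section

namespace ParabolicCaccioppoli

variable {d : ℕ} {U W : Set (E d)}

/-! ### Multiplication operators -/

section NormSq

variable {α X : Type*} [MeasurableSpace α] {μ : Measure α} [NormedAddCommGroup X]

theorem norm_sq_eq_integral (f : Lp X 2 μ) : ‖f‖ ^ 2 = ∫ x, ‖f x‖ ^ 2 ∂μ := by
  have h := ((Lp.memLp f).eLpNorm_eq_integral_rpow_norm (by norm_num) (by norm_num))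
  have h0 : 0 ≤ ∫ x, ‖f x‖ ^ 2 ∂μ := integral_nonneg fun x => by positivity
  rw [Lp.norm_def, h]
  simp only [ENNReal.toReal_ofNat, Real.rpow_ofNat]
  rw [ENNReal.toReal_ofReal (by positivity), ← Real.rpow_natCast, ← Real.rpow_mul h0]
  norm_num

theorem integrable_norm_sq (f : Lp X 2 μ) : Integrable (fun x => ‖f x‖ ^ 2) μ :=
  (Lp.memLp f).integrable_norm_pow (by norm_num)

theorem enorm_sq_eq_lintegral (f : Lp X 2 μ) : ‖f‖ₑ ^ 2 = ∫⁻ x, ‖f x‖ₑ ^ 2 ∂μ := by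
  rw [Lp.enorm_def, eLpNorm_eq_lintegral_rpow_enorm_toReal (by norm_num) (by norm_num),
    ← ENNReal.rpow_natCast, ← ENNReal.rpow_mul]
  simp

end NormSq

section Multiplication

variable {α X Y : Type*} [MeasurableSpace α] {μ : Measure α}
  [NormedAddCommGroup X] [NormedSpace ℝ X] [NormedAddCommGroup Y] [NormedSpace ℝ Y]

/-- Pointwise application `f ↦ (x ↦ A x (f x))` of an essentially bounded field of operators, as
an operator between `L²` spaces. -/
def mulL {A : α → X →L[ℝ] Y} (hA : MemLp A ∞ μ) : Lp X 2 μ →L[ℝ] Lp Y 2 μ :=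
  (ContinuousLinearMap.id ℝ (X →L[ℝ] Y)).holderL μ ∞ 2 2 hA.toLp

theorem coeFn_mulL {A : α → X →L[ℝ] Y} (hA : MemLp A ∞ μ) (f : Lp X 2 μ) :
    mulL hA f =ᵐ[μ] fun x => A x (f x) := by
  filter_upwards [(ContinuousLinearMap.id ℝ (X →L[ℝ] Y)).coeFn_holder (r := 2) hA.toLp f,
    hA.coeFn_toLp] with x hx hx'
  exact hx.trans (by simp [hx'])

theorem norm_mulL_le {A : α → X →L[ℝ] Y} (hA : MemLp A ∞ μ) {C : ℝ}
    (h : ∀ᵐ x ∂μ, ‖A x‖ ≤ C) (f : Lp X 2 μ) : ‖mulL hA f‖ ≤ C * ‖f‖ := by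
  refine Lp.norm_le_mul_norm_of_ae_le_mul ?_
  filter_upwards [coeFn_mulL hA f, h] with x hx hC
  rw [hx]
  exact (A x).le_of_opNorm_le hC _

end Multiplication

/-! ### Products of Sobolev functions and smooth functions -/

theorem IsTest.mono {X : Type*} [NormedAddCommGroup X] [NormedSpace ℝ X] {W W' : Set X}
    {φ : X → ℝ} (h : IsTest W φ) (hW : W ⊆ W') : IsTest W' φ :=
  ⟨h.1, h.2.1, h.2.2.trans hW⟩

theorem IsTest.mul {X : Type*} [NormedAddCommGroup X] [NormedSpace ℝ X] {W W' : Set X}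
    {φ ψ : X → ℝ} (hφ : IsTest W φ) (hψ : IsTest W' ψ) : IsTest (W ∩ W') (fun x => φ x * ψ x) :=
  ⟨hφ.1.mul hψ.1, hφ.2.1.mul_right, subset_inter
    ((tsupport_mul_subset_left (f := φ) (g := ψ)).trans hφ.2.2)
    ((tsupport_mul_subset_right (f := φ) (g := ψ)).trans hψ.2.2)⟩

theorem IsTest.sq {X : Type*} [NormedAddCommGroup X] [NormedSpace ℝ X] {W : Set X}
    {φ : X → ℝ} (hφ : IsTest W φ) : IsTest W (fun x => φ x * φ x) :=
  (hφ.mul hφ).mono inter_subset_left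

theorem IsTest.differentiableAt {X : Type*} [NormedAddCommGroup X] [NormedSpace ℝ X] {W : Set X}
    {φ : X → ℝ} (hφ : IsTest W φ) (x : X) : DifferentiableAt ℝ φ x :=
  hφ.1.differentiable (by simp) x

theorem inner_gradient {φ : E d → ℝ} (x e : E d) :
    inner ℝ (gradient φ x) e = fderiv ℝ φ x e := by
  simp [gradient]

theorem norm_gradient {φ : E d → ℝ} (x : E d) : ‖gradient φ x‖ = ‖fderiv ℝ φ x‖ := by
  simp [gradient]

theorem gradient_mul {φ ψ : E d → ℝ} {x : E d} (hφ : DifferentiableAt ℝ φ x)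
    (hψ : DifferentiableAt ℝ ψ x) :
    gradient (fun x => φ x * ψ x) x = φ x • gradient ψ x + ψ x • gradient φ x := by
  simp only [gradient]
  rw [fderiv_fun_mul hφ hψ, map_add, map_smul, map_smul]

theorem IsTest.continuous_gradient {W : Set (E d)} {φ : E d → ℝ} (hφ : IsTest W φ) :
    Continuous (gradient φ) :=
  (InnerProductSpace.toDual ℝ (E d)).symm.continuous.comp (hφ.1.continuous_fderiv (by simp))

theorem IsTest.exists_bound_gradient {W : Set (E d)} {φ : E d → ℝ} (hφ : IsTest W φ) :
    ∃ C, ∀ x, ‖gradient φ x‖ ≤ C := by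
  obtain ⟨C, hC⟩ := (hφ.2.1.fderiv (𝕜 := ℝ)).exists_bound_of_continuous
    (hφ.1.continuous_fderiv (by simp))
  exact ⟨C, fun x => by rw [norm_gradient]; exact hC x⟩

theorem IsTest.exists_bound {W : Set (E d)} {φ : E d → ℝ} (hφ : IsTest W φ) :
    ∃ C, ∀ x, ‖φ x‖ ≤ C :=
  hφ.2.1.exists_bound_of_continuous hφ.1.continuous

/-- Multiplication by the value of a test function is a bounded field of operators. -/
theorem IsTest.memLp_smul_id {W : Set (E d)} {φ : E d → ℝ} (hφ : IsTest W φ) (X : Type*)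
    [NormedAddCommGroup X] [NormedSpace ℝ X] (μ : Measure (E d)) :
    MemLp (fun x => φ x • ContinuousLinearMap.id ℝ X) ∞ μ := by
  obtain ⟨C, hC⟩ := hφ.exists_bound
  have hc : Continuous fun x => φ x • ContinuousLinearMap.id ℝ X :=
    hφ.1.continuous.smul continuous_const
  refine memLp_top_of_bound hc.aestronglyMeasurable
    (C * ‖ContinuousLinearMap.id ℝ X‖) (.of_forall fun x => ?_)
  rw [norm_smul]
  exact mul_le_mul_of_nonneg_right (hC x) (norm_nonneg _)

/-- Multiplication of scalars by the gradient of a test function is a bounded field of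
operators. -/
theorem IsTest.memLp_toSpanSingleton {W : Set (E d)} {φ : E d → ℝ} (hφ : IsTest W φ)
    (μ : Measure (E d)) :
    MemLp (fun x => ContinuousLinearMap.toSpanSingleton ℝ (gradient φ x)) ∞ μ := by
  obtain ⟨C, hC⟩ := hφ.exists_bound_gradient
  have hc : Continuous fun x => ContinuousLinearMap.toSpanSingleton ℝ (gradient φ x) :=
    (ContinuousLinearMap.toSpanSingletonCLE (𝕜 := ℝ) (E := E d)).continuous.comp
      hφ.continuous_gradient
  refine memLp_top_of_bound hc.aestronglyMeasurable C (.of_forall fun x => ?_)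
  rw [ContinuousLinearMap.norm_toSpanSingleton]
  exact hC x

/-- The map `f ↦ φ f` on `L²(U; X)`, for a test function `φ`. -/
def mulFn (U : Set (E d)) (X : Type*) [NormedAddCommGroup X] [NormedSpace ℝ X] {φ : E d → ℝ}
    (hφ : IsTest W φ) : Lp X 2 (volume.restrict U) →L[ℝ] Lp X 2 (volume.restrict U) :=
  mulL (hφ.memLp_smul_id X _)

/-- The map `f ↦ f ∇φ` from `L²(U)` to `L²(U; ℝ^d)`, for a test function `φ`. -/
def mulGrad (U : Set (E d)) {φ : E d → ℝ} (hφ : IsTest W φ) :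
    Lp ℝ 2 (volume.restrict U) →L[ℝ] Lp (E d) 2 (volume.restrict U) :=
  mulL (hφ.memLp_toSpanSingleton _)

theorem coeFn_mulFn {X : Type*} [NormedAddCommGroup X] [NormedSpace ℝ X] {φ : E d → ℝ}
    (hφ : IsTest W φ) (f : Lp X 2 (volume.restrict U)) :
    mulFn U X hφ f =ᵐ[volume.restrict U] fun x => φ x • f x :=
  coeFn_mulL _ _

theorem coeFn_mulGrad {φ : E d → ℝ} (hφ : IsTest W φ) (f : Lp ℝ 2 (volume.restrict U)) :
    mulGrad U hφ f =ᵐ[volume.restrict U] fun x => f x • gradient φ x :=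
  coeFn_mulL _ _

theorem norm_mulFn_le {X : Type*} [NormedAddCommGroup X] [NormedSpace ℝ X] {φ : E d → ℝ}
    (hφ : IsTest W φ) (h1 : ∀ x, |φ x| ≤ 1) (f : Lp X 2 (volume.restrict U)) :
    ‖mulFn U X hφ f‖ ≤ ‖f‖ := by
  refine Lp.norm_le_norm_of_ae_le ?_
  filter_upwards [coeFn_mulFn hφ f] with x hx
  rw [hx, norm_smul, Real.norm_eq_abs]
  exact mul_le_of_le_one_left (norm_nonneg _) (h1 x)

/-- The inclusion of `H¹(U)` into the pairs `(f, ∇f)`. -/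
def toPair (U : Set (E d)) : H1 U →L[ℝ] L2Pair U := (H1Submodule U).subtypeL

/-- `f ↦ f` from `H¹(U)` to `L²(U)`. -/
def fnL (U : Set (E d)) : H1 U →L[ℝ] Lp ℝ 2 (volume.restrict U) :=
  (WithLp.fstL 2 ℝ _ _).comp (toPair U)

/-- `f ↦ ∇f` from `H¹(U)` to `L²(U; ℝ^d)`. -/
def gradL (U : Set (E d)) : H1 U →L[ℝ] Lp (E d) 2 (volume.restrict U) :=
  (WithLp.sndL 2 ℝ _ _).comp (toPair U)

theorem H1.norm_sq (f : H1 U) : ‖f‖ ^ 2 = ‖fn f‖ ^ 2 + ‖grad f‖ ^ 2 :=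
  WithLp.prod_norm_sq_eq_of_L2 (toPair U f)

theorem IsTest.memLp_mul_fderiv {φ η : E d → ℝ} {W' : Set (E d)} (hφ : IsTest W φ)
    (hη : IsTest W' η) (e : E d) :
    MemLp (fun x => η x * fderiv ℝ φ x e) 2 (volume.restrict U) := by
  have hc : Continuous (fun x => η x * fderiv ℝ φ x e) := hη.1.continuous.mul
    ((hφ.1.continuous_fderiv (by simp)).clm_apply continuous_const)
  exact (hc.memLp_of_hasCompactSupport hη.2.1.mul_right).restrict U

theorem isWeakGradient_mul {φ : E d → ℝ} (hφ : IsTest W φ) (f : H1 U) :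
    IsWeakGradient U (mulFn U ℝ hφ (fn f))
      (mulFn U (E d) hφ (grad f) + mulGrad U hφ (fn f) : Lp (E d) 2 (volume.restrict U)) := by
  intro η hη e
  have hf : IsWeakGradient U (fn f) (grad f) := f.2
  have key := hf (fun x => φ x * η x) ((hφ.mul hη).mono inter_subset_right) e
  have h1 : ∫ x in U, mulFn U ℝ hφ (fn f) x * fderiv ℝ η x e =
      ∫ x in U, fn f x * (φ x * fderiv ℝ η x e) := by
    refine integral_congr_ae ?_
    filter_upwards [coeFn_mulFn hφ (fn f)] with x hx
    rw [hx, smul_eq_mul]; ring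
  have h2 : ∫ x in U, inner ℝ ((mulFn U (E d) hφ (grad f) + mulGrad U hφ (fn f) :
      Lp (E d) 2 (volume.restrict U)) x) e * η x =
      (∫ x in U, inner ℝ (grad f x) e * (φ x * η x)) +
        ∫ x in U, fn f x * (η x * fderiv ℝ φ x e) := by
    rw [← integral_add]
    · refine integral_congr_ae ?_
      filter_upwards [coeFn_mulFn hφ (grad f), coeFn_mulGrad hφ (fn f),
        Lp.coeFn_add (mulFn U (E d) hφ (grad f)) (mulGrad U hφ (fn f))] with x hx hx' hx''
      rw [hx'', Pi.add_apply, hx, hx', inner_add_left, real_inner_smul_left, real_inner_smul_left,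
        inner_gradient]
      ring
    · exact ((Lp.memLp (grad f)).inner_const e).integrable_mul (hφ.mul hη).memLp
    · exact (Lp.memLp (fn f)).integrable_mul (hφ.memLp_mul_fderiv hη e)
  have h3 : ∫ x in U, fn f x * fderiv ℝ (fun x => φ x * η x) x e =
      (∫ x in U, fn f x * (φ x * fderiv ℝ η x e)) +
        ∫ x in U, fn f x * (η x * fderiv ℝ φ x e) := by
    rw [← integral_add]
    · refine integral_congr_ae (.of_forall fun x => ?_)
      simp only [fderiv_fun_mul (hφ.differentiableAt x) (hη.differentiableAt x)]
      simp
      ring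
    · exact (Lp.memLp (fn f)).integrable_mul (hη.memLp_mul_fderiv hφ e)
    · exact (Lp.memLp (fn f)).integrable_mul (hφ.memLp_mul_fderiv hη e)
  rw [h1, h2]
  linarith

/-- Multiplication by a test function on `H¹(U)`. -/
def mulH1 (U : Set (E d)) {φ : E d → ℝ} (hφ : IsTest W φ) : H1 U →L[ℝ] H1 U :=
  ContinuousLinearMap.codRestrict
    ((WithLp.prodContinuousLinearEquiv 2 ℝ (Lp ℝ 2 (volume.restrict U))
      (Lp (E d) 2 (volume.restrict U))).symm.toContinuousLinearMap.comp
      (((mulFn U ℝ hφ).comp (fnL U)).prod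
        ((mulFn U (E d) hφ).comp (gradL U) + (mulGrad U hφ).comp (fnL U))))
    (H1Submodule U) (isWeakGradient_mul hφ)

theorem fn_mulH1 {φ : E d → ℝ} (hφ : IsTest W φ) (f : H1 U) :
    fn (mulH1 U hφ f) = mulFn U ℝ hφ (fn f) := rfl

theorem grad_mulH1 {φ : E d → ℝ} (hφ : IsTest W φ) (f : H1 U) :
    grad (mulH1 U hφ f) = mulFn U (E d) hφ (grad f) + mulGrad U hφ (fn f) := rfl

theorem mulH1_mem_testSubmodule {φ : E d → ℝ} (hφ : IsTest W φ) {f : H1 U}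
    (hf : f ∈ testSubmodule U U) : mulH1 U hφ f ∈ testSubmodule U (W ∩ U) := by
  obtain ⟨η, hη, h1, h2⟩ := hf
  refine ⟨fun x => φ x * η x, hφ.mul hη, ?_, ?_⟩
  · filter_upwards [coeFn_mulFn hφ (fn f), h1] with x hx hx1
    rw [fn_mulH1, hx, hx1, smul_eq_mul]
  · filter_upwards [coeFn_mulFn hφ (grad f), coeFn_mulGrad hφ (fn f), h1, h2,
      Lp.coeFn_add (mulFn U (E d) hφ (grad f)) (mulGrad U hφ (fn f))] with x hx hx' hx1 hx2 hx3
    rw [grad_mulH1, hx3, Pi.add_apply, hx, hx', hx1, hx2,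
      gradient_mul (hφ.differentiableAt x) (hη.differentiableAt x)]

theorem mulH1_mem_H10Submodule {φ : E d → ℝ} (hφ : IsTest W φ) {f : H1 U}
    (hf : f ∈ H10Submodule U U) : mulH1 U hφ f ∈ H10Submodule U (W ∩ U) :=
  map_mem_closure (mulH1 U hφ).continuous hf fun _ => mulH1_mem_testSubmodule hφ

/-- Multiplication by a test function `φ ∈ C_c^∞(W)`, from `H¹₀(U)` to `H¹₀(W ∩ U)`. -/
def mulH10 (U : Set (E d)) {φ : E d → ℝ} (hφ : IsTest W φ) : H10 U U →L[ℝ] H10 U (W ∩ U) :=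
  ((mulH1 U hφ).comp toH1).codRestrict (H10Submodule U (W ∩ U))
    fun g => mulH1_mem_H10Submodule hφ (Subtype.property g)

theorem toH1_mulH10 {φ : E d → ℝ} (hφ : IsTest W φ) (g : H10 U U) :
    toH1 (mulH10 U hφ g) = mulH1 U hφ (toH1 g) := rfl

theorem norm_toH1 (g : H10 U W) : ‖toH1 g‖ = ‖g‖ := rfl

theorem isEmbedding_toH1 : IsEmbedding (toH1 : H10 U W → H1 U) := IsEmbedding.subtypeVal

/-! ### The time derivative tested with the solution -/

theorem IsTest.slice {T₀ : ℝ} {φ : E d × ℝ → ℝ} (hφ : IsTest (U ×ˢ Ioi T₀) φ) (t : ℝ) :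
    IsTest U (fun x => φ (x, t)) := by
  have hsub : tsupport (fun x => φ (x, t)) ⊆ (fun x : E d => (x, t)) ⁻¹' tsupport φ :=
    tsupport_comp_subset_preimage φ (by fun_prop)
  refine ⟨hφ.1.comp (contDiff_id.prodMk contDiff_const), ?_, fun x hx => (hφ.2.2 (hsub hx)).1⟩
  exact (hφ.2.1.image continuous_fst).of_isClosed_subset (isClosed_tsupport _)
    fun x hx => ⟨(x, t), hsub hx, rfl⟩

theorem IsTest.hasDerivAt_slice {S : Set (E d × ℝ)} {φ : E d × ℝ → ℝ} (hφ : IsTest S φ)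
    (x : E d) (t : ℝ) : HasDerivAt (fun s => φ (x, s)) (fderiv ℝ φ (x, t) (0, 1)) t :=
  (hφ.differentiableAt (x, t)).hasFDerivAt.comp_hasDerivAt t
    ((hasDerivAt_const t x).prodMk (hasDerivAt_id t))

/-- The energy inequality for smooth functions vanishing at the initial time. The integrand is the
time derivative of `(1 - t) χ² φ² / 2`; the weight `1 - t` is what produces the `L²` norm of `χ φ`
on the left-hand side. -/
theorem smooth_energy {T₀ s : ℝ} (hs : s ≤ 1) {φ : E d × ℝ → ℝ} {χ : E d → ℝ}
    (hφ : IsTest (U ×ˢ Ioi T₀) φ) (hχ : Continuous χ) :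
    0 ≤ ∫ t in Ioo T₀ s, ∫ x in U, ((1 - t) * (deriv (fun s => φ (x, s)) t *
      (χ x ^ 2 * φ (x, t))) - (1 / 2) * (χ x * φ (x, t)) ^ 2) := by
  rcases le_or_gt s T₀ with h | h
  · simp [Ioo_eq_empty (not_lt.2 h)]
  set F : ℝ → E d → ℝ := fun t x => (1 - t) * (deriv (fun s => φ (x, s)) t *
      (χ x ^ 2 * φ (x, t))) - (1 / 2) * (χ x * φ (x, t)) ^ 2 with hF
  have hF' : F = fun t x => ((1 - t) * (fderiv ℝ φ (x, t) (0, 1) * χ x ^ 2)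
      - (1 / 2) * χ x ^ 2 * φ (x, t)) * φ (x, t) := by
    ext t x
    rw [hF]
    simp only [(hφ.hasDerivAt_slice x t).deriv]
    ring
  have hcφ := hφ.1.continuous
  have hcD : Continuous (fderiv ℝ φ) := hφ.1.continuous_fderiv (by simp)
  have hFc : Continuous (Function.uncurry F) := by
    rw [hF']
    unfold Function.uncurry
    fun_prop
  have hFs : HasCompactSupport (Function.uncurry F) := by
    have h1 : HasCompactSupport fun p : ℝ × E d => φ (p.2, p.1) :=
      hφ.2.1.comp_homeomorph (Homeomorph.prodComm ℝ (E d))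
    rw [hF']
    exact h1.mul_left
  have hint : Integrable (Function.uncurry F)
      ((volume.restrict (Ioo T₀ s)).prod (volume.restrict U)) := by
    rw [Measure.prod_restrict]
    exact (hFc.integrable_of_hasCompactSupport hFs).restrict
  rw [integral_integral_swap hint]
  refine integral_nonneg fun x => ?_
  have hderiv : ∀ t ∈ uIcc T₀ s,
      HasDerivAt (fun t => (1 / 2) * (1 - t) * (χ x * φ (x, t)) ^ 2) (F t x) t := by
    intro t _
    have h1 := hφ.hasDerivAt_slice x t
    have h2 := ((((hasDerivAt_id t).const_sub 1).const_mul (1 / 2)).mul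
      ((h1.const_mul (χ x)).pow 2))
    refine h2.congr_deriv ?_
    rw [hF']
    simp
    ring
  have hFTC := intervalIntegral.integral_eq_sub_of_hasDerivAt hderiv
    ((show Continuous fun t => F t x from
      hFc.comp (continuous_id.prodMk continuous_const)).intervalIntegrable _ _)
  rw [intervalIntegral.integral_of_le h.le, integral_Ioc_eq_integral_Ioo] at hFTC
  have h0 : φ (x, T₀) = 0 := by
    by_contra hne
    exact lt_irrefl T₀ (hφ.2.2 (subset_tsupport φ hne)).2
  change 0 ≤ ∫ t in Ioo T₀ s, F t x
  rw [hFTC, h0]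
  have : 0 ≤ 1 - s := by linarith
  simp only [mul_zero, ne_eq, OfNat.ofNat_ne_zero, not_false_eq_true, zero_pow, sub_zero]
  positivity

/-- An element of the closed subspace `H¹₀(U)` of `H¹(U)`, as a point of the type `H10 U U`. -/
def mkH10 (f : H1 U) (h : f ∈ H10Submodule U U) : H10 U U := (⟨f, h⟩ : H10Submodule U U)

open Classical in
/-- An element of `H¹(U)` as an element of `H¹₀(U)`, with the value `0` off `H¹₀(U)`. -/
def toH10 (f : H1 U) : H10 U U :=
  if h : f ∈ H10Submodule U U then mkH10 f h else 0

theorem toH1_toH10 {f : H1 U} (h : f ∈ H10Submodule U U) : toH1 (toH10 f) = f := by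
  unfold toH10
  rw [dif_pos h]
  rfl

theorem memLp_toH10 {μ : Measure ℝ} {v : ℝ → H1 U} (hv : MemLp v 2 μ)
    (hmem : ∀ᵐ t ∂μ, v t ∈ H10Submodule U U) : MemLp (fun t => toH10 (v t)) 2 μ := by
  have hae : (fun t => toH1 (toH10 (v t))) =ᵐ[μ] v := by
    filter_upwards [hmem] with t ht using toH1_toH10 ht
  have hm : AEStronglyMeasurable (fun t => toH10 (v t)) μ :=
    (isEmbedding_toH1 (U := U) (W := U)).aestronglyMeasurable_comp_iff.1
      (hv.1.congr hae.symm)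
  refine hv.of_le hm ?_
  filter_upwards [hae] with t ht
  rw [← norm_toH1, ht]

/-- If `u` is a smooth map that vanishes near the parabolic boundary, each `u t` is a test
function. -/
theorem IsSmoothMap.mem {T₀ T₁ : ℝ} {φ : E d × ℝ → ℝ} {u : ℝ → H1 U} {u' : ℝ → HNeg U U}
    (hφ : IsTest (U ×ˢ Ioi T₀) φ) (hu : IsSmoothMap T₀ T₁ φ u u') {t : ℝ} (ht : t ∈ Ioo T₀ T₁) :
    u t ∈ H10Submodule U U :=
  subset_closure ⟨_, hφ.slice t, (hu t ht).1⟩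

/-- Functions in `H¹_{par,⊔}` take values in `H¹₀(U)`: the distance to this closed space has
vanishing `L²` norm in time. -/
theorem MemHParZero.ae_mem {T₀ T₁ : ℝ} {v : ℝ → H1 U} {v' : ℝ → HNeg U U}
    (hv : MemHParZero T₀ T₁ v v') :
    ∀ᵐ t ∂volume.restrict (Ioo T₀ T₁), v t ∈ H10Submodule U U := by
  set S : Set (H1 U) := {f | f ∈ H10Submodule U U}
  have hclosed : IsClosed S := (testSubmodule U U).isClosed_topologicalClosure
  have hne : S.Nonempty := ⟨0, (H10Submodule U U).zero_mem⟩
  have hm : AEStronglyMeasurable (fun t => Metric.infDist (v t) S)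
      (volume.restrict (Ioo T₀ T₁)) :=
    (Metric.continuous_infDist_pt S).comp_aestronglyMeasurable hv.memHPar.memLp.1
  have h0 : eLpNorm (fun t => Metric.infDist (v t) S) 2 (volume.restrict (Ioo T₀ T₁)) = 0 := by
    refine le_antisymm (le_of_forall_pos_le_add fun ε hε => ?_) zero_le
    obtain ⟨φ, hφ, u, u', hu, -, hlt⟩ := hv.mem_closure ε hε
    rw [zero_add]
    refine le_trans (eLpNorm_mono_ae ?_) (le_self_add.trans hlt.le)
    filter_upwards [ae_restrict_mem measurableSet_Ioo] with t ht
    rw [Real.norm_eq_abs, abs_of_nonneg Metric.infDist_nonneg]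
    exact (Metric.infDist_le_dist_of_mem (hu.mem hφ ht)).trans_eq (dist_eq_norm _ _)
  filter_upwards [(eLpNorm_eq_zero_iff hm (by norm_num)).1 h0] with t ht
  exact (hclosed.mem_iff_infDist_zero hne).2 ht

/-- `f ↦ χ² f` on `H¹₀(U)`. -/
def mulSq (U : Set (E d)) {χ : E d → ℝ} (hχ : IsTest W χ) : H10 U U →L[ℝ] H10 U U :=
  (inclH10 inter_subset_right).comp (mulH10 U hχ.sq)

/-- `f ↦ χ f` from `H¹(U)` to `L²(U)`. -/
def cutFn (U : Set (E d)) {χ : E d → ℝ} (hχ : IsTest W χ) :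
    H1 U →L[ℝ] Lp ℝ 2 (volume.restrict U) := (mulFn U ℝ hχ).comp (fnL U)

theorem toH1_mulSq {χ : E d → ℝ} (hχ : IsTest W χ) (g : H10 U U) :
    toH1 (mulSq U hχ g) = mulH1 U hχ.sq (toH1 g) := rfl

/-- The energy inequality for an approximating smooth map. -/
theorem IsSmoothMap.energy {T₀ T₁ s : ℝ} (hsT : s ≤ T₁) (hs : s ≤ 1) {φ : E d × ℝ → ℝ}
    {u : ℝ → H1 U} {u' : ℝ → HNeg U U} (hφ : IsTest (U ×ˢ Ioi T₀) φ)
    (hu : IsSmoothMap T₀ T₁ φ u u') {χ : E d → ℝ} (hχ : IsTest W χ) :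
    0 ≤ ∫ t in Ioo T₀ s, ((1 - t) * u' t (mulSq U hχ (toH10 (u t)))
      - (1 / 2) * ‖cutFn U hχ (toH1 (toH10 (u t)))‖ ^ 2) := by
  refine (smooth_energy hs hφ hχ.1.continuous).trans_eq
    (setIntegral_congr_fun measurableSet_Ioo fun t ht => ?_)
  have ht' : t ∈ Ioo T₀ T₁ := ⟨ht.1, ht.2.trans_le hsT⟩
  have h1 := toH1_toH10 (hu.mem hφ ht')
  have hφt := hφ.slice t
  have hder : Continuous fun x => deriv (fun s => φ (x, s)) t := by
    simp only [fun x => (hφ.hasDerivAt_slice x t).deriv]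
    have hcD : Continuous (fderiv ℝ φ) := hφ.1.continuous_fderiv (by simp)
    fun_prop
  have hχc := hχ.1.continuous
  have hφc := hφt.1.continuous
  rw [h1, (hu t ht').2, toH1_mulSq, h1, integral_sub, integral_const_mul, integral_const_mul,
    norm_sq_eq_integral]
  · congr 2
    · refine integral_congr_ae ?_
      filter_upwards [coeFn_mulFn hχ.sq (fn (u t)), (hu t ht').1.1] with x hx hx1
      rw [fn_mulH1, hx, hx1, smul_eq_mul, sq]
    · refine integral_congr_ae ?_
      filter_upwards [coeFn_mulFn hχ (fn (u t)), (hu t ht').1.1] with x hx hx1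
      change _ = ‖mulFn U ℝ hχ (fn (u t)) x‖ ^ 2
      rw [hx, hx1, smul_eq_mul, Real.norm_eq_abs, sq_abs]
  · refine ((continuous_const.mul (hder.mul ((hχc.pow 2).mul hφc))).integrable_of_hasCompactSupport
      ?_).restrict
    exact (hφt.2.1.mul_left.mul_left).mul_left
  · refine ((continuous_const.mul ((hχc.mul hφc).pow 2)).integrable_of_hasCompactSupport ?_).restrict
    simp only [sq]
    exact (hφt.2.1.mul_left.mul_left).mul_left

/-- The energy inequality in `H¹_{par,⊔}`. Both terms are continuous bilinear pairings on `L²` in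
time, so that the inequality passes to the closure of the smooth maps. -/
theorem MemHParZero.energy {T₀ T₁ s : ℝ} (hT₀ : 0 ≤ T₀) (hsT : s ≤ T₁) (hs : s ≤ 1)
    {v : ℝ → H1 U} {v' : ℝ → HNeg U U} (hv : MemHParZero T₀ T₁ v v')
    {χ : E d → ℝ} (hχ : IsTest W χ) :
    (1 / 2) * (∫ t in Ioo T₀ s, ‖cutFn U hχ (v t)‖ ^ 2) ≤
      ∫ t in Ioo T₀ s, (1 - t) * v' t (mulSq U hχ (toH10 (v t))) := by
  have hsub : Ioo T₀ s ⊆ Ioo T₀ T₁ := Ioo_subset_Ioo_right hsT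
  have hμ : volume.restrict (Ioo T₀ s) ≤ volume.restrict (Ioo T₀ T₁) :=
    Measure.restrict_mono_set _ hsub
  set μ := volume.restrict (Ioo T₀ s) with hμdef
  have hθ : ∀ᵐ t ∂μ, ‖(1 - t : ℝ)‖ ≤ 1 := by
    filter_upwards [ae_restrict_mem measurableSet_Ioo] with t ht
    rw [Real.norm_eq_abs, abs_le]
    constructor <;> linarith [ht.1, ht.2]
  have hθm : AEStronglyMeasurable (fun t : ℝ => 1 - t) μ :=
    (continuous_const.sub continuous_id).aestronglyMeasurable
  have memW : ∀ {w' : ℝ → HNeg U U}, MemLp w' 2 (volume.restrict (Ioo T₀ T₁)) →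
      MemLp (fun t => (1 - t) • w' t) 2 μ := by
    intro w' hw'
    refine (hw'.mono_measure hμ).of_le (hθm.smul (hw'.mono_measure hμ).1) ?_
    filter_upwards [hθ] with t ht
    rw [norm_smul]
    exact mul_le_of_le_one_left (norm_nonneg _) ht
  -- The two pairings, as continuous bilinear maps on `L²(μ)`.
  let B : HNeg U U →L[ℝ] H10 U U →L[ℝ] ℝ :=
    (ContinuousLinearMap.compL ℝ (H10 U U) (H10 U U) ℝ).flip (mulSq U hχ)
  let q : H10 U U →L[ℝ] H10 U U →L[ℝ] ℝ :=
    (innerSL ℝ).bilinearComp ((cutFn U hχ).comp toH1) ((cutFn U hχ).comp toH1)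
  let Φ : Lp (HNeg U U) 2 μ × Lp (H10 U U) 2 μ → ℝ := fun p =>
    B.lpPairing μ 2 2 p.1 p.2 - (1 / 2) * q.lpPairing μ 2 2 p.2 p.2
  have hΦ : Continuous Φ := by fun_prop
  have hΦeq : ∀ {w' : ℝ → HNeg U U} {w : ℝ → H10 U U} (hw' : MemLp (fun t => (1 - t) • w' t) 2 μ)
      (hw : MemLp w 2 μ), Φ (hw'.toLp, hw.toLp) = ∫ t, ((1 - t) * w' t (mulSq U hχ (w t))
        - (1 / 2) * ‖cutFn U hχ (toH1 (w t))‖ ^ 2) ∂μ ∧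
      Φ (hw'.toLp, hw.toLp) = (∫ t, (1 - t) * w' t (mulSq U hχ (w t)) ∂μ)
        - (1 / 2) * ∫ t, ‖cutFn U hχ (toH1 (w t))‖ ^ 2 ∂μ := by
    intro w' w hw' hw
    have hB : (fun t => B ((hw'.toLp _ : Lp _ 2 μ) t) ((hw.toLp _ : Lp _ 2 μ) t)) =ᵐ[μ]
        fun t => (1 - t) * w' t (mulSq U hχ (w t)) := by
      filter_upwards [hw'.coeFn_toLp, hw.coeFn_toLp] with t h1 h2
      rw [h1, h2]
      rfl
    have hq : (fun t => q ((hw.toLp _ : Lp _ 2 μ) t) ((hw.toLp _ : Lp _ 2 μ) t)) =ᵐ[μ]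
        fun t => ‖cutFn U hχ (toH1 (w t))‖ ^ 2 := by
      filter_upwards [hw.coeFn_toLp] with t h2
      rw [h2, ← real_inner_self_eq_norm_sq]
      rfl
    have e2 : Φ (hw'.toLp, hw.toLp) = (∫ t, (1 - t) * w' t (mulSq U hχ (w t)) ∂μ)
        - (1 / 2) * ∫ t, ‖cutFn U hχ (toH1 (w t))‖ ^ 2 ∂μ := by
      change B.lpPairing μ 2 2 _ _ - (1 / 2) * q.lpPairing μ 2 2 _ _ = _
      rw [ContinuousLinearMap.lpPairing_eq_integral, ContinuousLinearMap.lpPairing_eq_integral,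
        integral_congr_ae hB, integral_congr_ae hq]
    refine ⟨?_, e2⟩
    have i1 : Integrable (fun t => B ((hw'.toLp _ : Lp _ 2 μ) t) ((hw.toLp _ : Lp _ 2 μ) t)) μ :=
      memLp_one_iff_integrable.1 (B.memLp_of_bilin 1 (Lp.memLp _) (Lp.memLp _))
    have i2 : Integrable (fun t => q ((hw.toLp _ : Lp _ 2 μ) t) ((hw.toLp _ : Lp _ 2 μ) t)) μ :=
      memLp_one_iff_integrable.1 (q.memLp_of_bilin 1 (Lp.memLp _) (Lp.memLp _))
    rw [integral_sub (i1.congr hB) ((i2.congr hq).const_mul _), integral_const_mul, e2]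
  have hmem := hv.ae_mem
  have hmemμ : ∀ᵐ t ∂μ, v t ∈ H10Submodule U U := ae_mono hμ hmem
  have hw' := memW hv.memHPar.memLp_deriv
  have hw := memLp_toH10 (hv.memHPar.memLp.mono_measure hμ) hmemμ
  have hcl : (hw'.toLp, hw.toLp) ∈ closure {p | 0 ≤ Φ p} := by
    rw [EMetric.mem_closure_iff]
    intro ε hε
    obtain ⟨φ, hφ, u, u', hu, huP, hlt⟩ := hv.mem_closure ε hε
    have humem : ∀ᵐ t ∂μ, u t ∈ H10Submodule U U := by
      filter_upwards [ae_restrict_mem measurableSet_Ioo] with t ht using hu.mem hφ (hsub ht)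
    have hz' := memW huP.memLp_deriv
    have hz := memLp_toH10 (huP.memLp.mono_measure hμ) humem
    refine ⟨(hz'.toLp, hz.toLp), ?_, ?_⟩
    · rw [mem_ofPred_eq, (hΦeq hz' hz).1]
      exact hu.energy hsT hs hφ hχ
    · rw [Prod.edist_eq, Lp.edist_toLp_toLp, Lp.edist_toLp_toLp]
      refine lt_of_le_of_lt (max_le ?_ ?_) hlt
      · refine le_trans ?_ le_add_self
        refine le_trans (eLpNorm_mono_ae ?_) (eLpNorm_mono_measure _ hμ)
        filter_upwards [hθ] with t ht
        simp only [Pi.sub_apply]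
        rw [show (1 - t) • v' t - (1 - t) • u' t = (1 - t) • (v' t - u' t) from
          (smul_sub _ _ _).symm, norm_smul]
        exact mul_le_of_le_one_left (norm_nonneg _) ht
      · refine le_trans ?_ le_self_add
        refine le_trans (eLpNorm_mono_ae ?_) (eLpNorm_mono_measure _ hμ)
        filter_upwards [hmemμ, humem] with t h1 h2
        simp only [Pi.sub_apply]
        rw [← norm_toH1, map_sub, toH1_toH10 h1, toH1_toH10 h2]
  have hclosed : IsClosed {p | 0 ≤ Φ p} := isClosed_le continuous_const hΦ
  rw [hclosed.closure_eq, mem_ofPred_eq, (hΦeq hw' hw).2] at hcl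
  have hN : ∫ t, ‖cutFn U hχ (toH1 (toH10 (v t)))‖ ^ 2 ∂μ = ∫ t, ‖cutFn U hχ (v t)‖ ^ 2 ∂μ := by
    refine integral_congr_ae ?_
    filter_upwards [hmemμ] with t ht
    rw [toH1_toH10 ht]
  rw [hN] at hcl
  linarith

/-! ### The elliptic form at a fixed time -/

/-- The integrand of the elliptic part of the equation at time `t`, tested with `f`. -/
def formDensity (Λ : ℝ) (a : E d × ℝ → Matrix (Fin d) (Fin d) ℝ)
    (b : E d × ℝ → E d) (c : E d × ℝ → ℝ) (t : ℝ) (f g : H1 U) (x : E d) : ℝ :=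
  inner ℝ (grad f x) (Matrix.toEuclideanLin (a (x, t)) (grad g x))
    - fn f x * inner ℝ (b (x, t)) (grad g x)
    - c (x, t) * fn g x * fn f x
    + Λ * fn g x * fn f x

/-- The pointwise bounds on the coefficients, almost everywhere on the time slice at `t`. -/
def IsAdmissibleSlice (lam Λ : ℝ) (a : E d × ℝ → Matrix (Fin d) (Fin d) ℝ)
    (b : E d × ℝ → E d) (c : E d × ℝ → ℝ) (t : ℝ) : Prop :=
  ∀ᵐ x, (a (x, t)).IsSymm ∧
    (∀ ξ : E d, ‖ξ‖ ^ 2 ≤ inner ℝ ξ (Matrix.toEuclideanLin (a (x, t)) ξ) ∧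
      inner ℝ ξ (Matrix.toEuclideanLin (a (x, t)) ξ) ≤ lam * ‖ξ‖ ^ 2) ∧
    ‖b (x, t)‖ ^ 2 ≤ Λ ∧ c (x, t) ≤ 0 ∧ |c (x, t)| ^ 2 ≤ Λ

theorem ae_norm_sq_le_of_eLpNorm_top_sq_le {α X : Type*} [MeasurableSpace α] {μ : Measure α}
    [NormedAddCommGroup X] {f : α → X} {Λ : ℝ} (hΛ : 0 ≤ Λ)
    (h : eLpNorm f ∞ μ ^ 2 ≤ ENNReal.ofReal Λ) : ∀ᵐ x ∂μ, ‖f x‖ ^ 2 ≤ Λ := by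
  rw [eLpNorm_exponent_top] at h
  filter_upwards [enorm_ae_le_eLpNormEssSup f μ] with x hx
  have h1 : ‖f x‖ₑ ^ 2 ≤ ENNReal.ofReal Λ := (pow_le_pow_left' hx 2).trans h
  rw [← ofReal_norm, ← ENNReal.ofReal_pow (norm_nonneg _)] at h1
  exact (ENNReal.ofReal_le_ofReal_iff hΛ).1 h1

theorem IsAdmissible.ae_slice {lam Λ : ℝ} (hΛ : 0 ≤ Λ) {a : E d × ℝ → Matrix (Fin d) (Fin d) ℝ}
    {b : E d × ℝ → E d} {c : E d × ℝ → ℝ} (h : IsAdmissible lam Λ a b c) :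
    ∀ᵐ t, IsAdmissibleSlice lam Λ a b c t := by
  have h1 := h.symm.and (h.elliptic.and
    ((ae_norm_sq_le_of_eLpNorm_top_sq_le hΛ h.bound_b).and
      (h.nonpos_c.and (ae_norm_sq_le_of_eLpNorm_top_sq_le hΛ h.bound_c))))
  have hswap : Measure.QuasiMeasurePreserving (Prod.swap : ℝ × E d → E d × ℝ) volume volume :=
    (Measure.measurePreserving_swap (μ := (volume : Measure ℝ))
      (ν := (volume : Measure (E d)))).quasiMeasurePreserving
  exact Measure.ae_ae_of_ae_prod (hswap.ae h1)

theorem inner_toEuclideanLin_single (m : Matrix (Fin d) (Fin d) ℝ) (i j : Fin d) :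
    inner ℝ (EuclideanSpace.single i (1 : ℝ))
      (Matrix.toEuclideanLin m (EuclideanSpace.single j (1 : ℝ))) = m i j := by
  simp [EuclideanSpace.inner_single_left]

/-- The entries of a symmetric matrix are bounded by the upper bound of its quadratic form, by
polarization. -/
theorem abs_entry_le {lam : ℝ} {m : Matrix (Fin d) (Fin d) ℝ} (hm : m.IsSymm)
    (h : ∀ ξ : E d, ‖ξ‖ ^ 2 ≤ inner ℝ ξ (Matrix.toEuclideanLin m ξ) ∧
      inner ℝ ξ (Matrix.toEuclideanLin m ξ) ≤ lam * ‖ξ‖ ^ 2) (i j : Fin d) :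
    |m i j| ≤ lam := by
  set e : E d := EuclideanSpace.single i 1
  set e' : E d := EuclideanSpace.single j 1
  have hp := (sq_nonneg _).trans (h (e + e')).1
  have hn := (sq_nonneg _).trans (h (e - e')).1
  have h1 := (h e).2
  have h2 := (h e').2
  have n1 : ‖e‖ = 1 := by simp [e]
  have n2 : ‖e'‖ = 1 := by simp [e']
  have hij : inner ℝ e (Matrix.toEuclideanLin m e') = m i j := inner_toEuclideanLin_single m i j
  have hji : inner ℝ e' (Matrix.toEuclideanLin m e) = m i j := by
    rw [inner_toEuclideanLin_single m j i, hm.apply]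
  simp only [map_add, map_sub, inner_add_left, inner_add_right, inner_sub_left, inner_sub_right,
    hij, hji] at hp hn
  rw [n1] at h1
  rw [n2] at h2
  rw [abs_le]
  constructor <;> linarith

/-- The elementary operator with matrix `single i j 1`. -/
def matrixUnit (i j : Fin d) : E d →L[ℝ] E d :=
  (Matrix.toEuclideanLin (Matrix.single i j (1 : ℝ))).toContinuousLinearMap

/-- The expansion in matrix units, by which measurability of the entries gives measurability of
the field of operators. -/
theorem toEuclideanLin_eq_sum (m : Matrix (Fin d) (Fin d) ℝ) :
    (Matrix.toEuclideanLin m).toContinuousLinearMap = ∑ i, ∑ j, m i j • matrixUnit i j := by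
  conv_lhs => rw [Matrix.matrix_eq_sum_single m]
  simp only [map_sum, matrixUnit, ← map_smul]
  simp

section Slice

variable {lam Λ : ℝ} {a : E d × ℝ → Matrix (Fin d) (Fin d) ℝ}
    {b : E d × ℝ → E d} {c : E d × ℝ → ℝ}

theorem IsAdmissibleSlice.norm_a_le {t : ℝ} (ht : IsAdmissibleSlice lam Λ a b c t) :
    ∀ᵐ x ∂volume.restrict U, ‖(Matrix.toEuclideanLin (a (x, t))).toContinuousLinearMap‖ ≤
      ∑ i, ∑ j, lam * ‖(matrixUnit i j : E d →L[ℝ] E d)‖ := by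
  filter_upwards [ae_restrict_of_ae ht] with x hx
  rw [toEuclideanLin_eq_sum]
  refine norm_sum_le_of_le _ fun i _ => norm_sum_le_of_le _ fun j _ => ?_
  rw [norm_smul]
  exact mul_le_mul_of_nonneg_right (abs_entry_le hx.1 hx.2.1 i j) (norm_nonneg _)

theorem IsAdmissibleSlice.norm_b_le {t : ℝ} (ht : IsAdmissibleSlice lam Λ a b c t) :
    ∀ᵐ x ∂volume.restrict U, ‖innerSL ℝ (b (x, t))‖ ≤ Real.sqrt Λ := by
  filter_upwards [ae_restrict_of_ae ht] with x hx
  rw [innerSL_apply_norm]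
  exact Real.le_sqrt_of_sq_le hx.2.2.1

theorem IsAdmissibleSlice.norm_c_le {t : ℝ} (ht : IsAdmissibleSlice lam Λ a b c t) :
    ∀ᵐ x ∂volume.restrict U, ‖c (x, t) • ContinuousLinearMap.id ℝ ℝ‖ ≤ Real.sqrt Λ := by
  filter_upwards [ae_restrict_of_ae ht] with x hx
  rw [norm_smul, ContinuousLinearMap.norm_id, mul_one, Real.norm_eq_abs]
  exact Real.le_sqrt_of_sq_le hx.2.2.2.2

theorem IsAdmissible.memLp_a (h : IsAdmissible lam Λ a b c) {t : ℝ}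
    (ht : IsAdmissibleSlice lam Λ a b c t) :
    MemLp (fun x => (Matrix.toEuclideanLin (a (x, t))).toContinuousLinearMap) ∞
      (volume.restrict U) := by
  have hm : StronglyMeasurable fun x => (Matrix.toEuclideanLin (a (x, t))).toContinuousLinearMap := by
    simp only [toEuclideanLin_eq_sum]
    refine Finset.stronglyMeasurable_fun_sum _ fun i _ =>
      Finset.stronglyMeasurable_fun_sum _ fun j _ => ?_
    exact (((h.measurable_a i j).comp measurable_prodMk_right).stronglyMeasurable).smul_const _
  exact memLp_top_of_bound hm.aestronglyMeasurable _ ht.norm_a_le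

theorem IsAdmissible.memLp_b (h : IsAdmissible lam Λ a b c) {t : ℝ}
    (ht : IsAdmissibleSlice lam Λ a b c t) :
    MemLp (fun x => innerSL ℝ (b (x, t))) ∞ (volume.restrict U) := by
  have hm : StronglyMeasurable fun x => innerSL ℝ (b (x, t)) :=
    (innerSL ℝ).continuous.comp_stronglyMeasurable
      (h.measurable_b.comp measurable_prodMk_right).stronglyMeasurable
  exact memLp_top_of_bound hm.aestronglyMeasurable _ ht.norm_b_le

theorem IsAdmissible.memLp_c (h : IsAdmissible lam Λ a b c) {t : ℝ}
    (ht : IsAdmissibleSlice lam Λ a b c t) :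
    MemLp (fun x => c (x, t) • ContinuousLinearMap.id ℝ ℝ) ∞ (volume.restrict U) := by
  have hm : StronglyMeasurable fun x => c (x, t) • ContinuousLinearMap.id ℝ ℝ :=
    ((h.measurable_c.comp measurable_prodMk_right).stronglyMeasurable).smul_const _
  exact memLp_top_of_bound hm.aestronglyMeasurable _ ht.norm_c_le

theorem norm_fn_le (f : H1 U) : ‖fn f‖ ≤ ‖f‖ := by
  refine (sq_le_sq₀ (norm_nonneg _) (norm_nonneg _)).1 ?_
  rw [H1.norm_sq]
  exact le_add_of_nonneg_right (sq_nonneg _)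

theorem norm_grad_le (f : H1 U) : ‖grad f‖ ≤ ‖f‖ := by
  refine (sq_le_sq₀ (norm_nonneg _) (norm_nonneg _)).1 ?_
  rw [H1.norm_sq]
  exact le_add_of_nonneg_left (sq_nonneg _)

theorem abs_inner_le_of_norm_le {X : Type*} [NormedAddCommGroup X] [InnerProductSpace ℝ X]
    {C p q : ℝ} {x y : X} (hx : ‖x‖ ≤ p) (hy : ‖y‖ ≤ C * q) : |inner ℝ x y| ≤ C * (p * q) :=
  calc |inner ℝ x y| ≤ ‖x‖ * ‖y‖ := abs_real_inner_le_norm _ _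
    _ ≤ p * (C * q) := mul_le_mul hx hy (norm_nonneg _) ((norm_nonneg _).trans hx)
    _ = C * (p * q) := by ring

/-- A bound of the form on admissible time slices. -/
def formBound (d : ℕ) (lam Λ : ℝ) : ℝ :=
  (∑ i, ∑ j, lam * ‖(matrixUnit i j : E d →L[ℝ] E d)‖) + Real.sqrt Λ + Real.sqrt Λ + Λ

/-- On an admissible time slice the form is given by a continuous bilinear form on `H¹(U)`. -/
theorem IsAdmissible.exists_bilin (hlam : 0 ≤ lam) (hΛ : 0 ≤ Λ) (h : IsAdmissible lam Λ a b c) {t : ℝ}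
    (ht : IsAdmissibleSlice lam Λ a b c t) (U : Set (E d)) :
    ∃ B : H1 U →L[ℝ] H1 U →L[ℝ] ℝ, ∀ f g,
      Integrable (formDensity Λ a b c t f g) (volume.restrict U) ∧
      ∫ x in U, formDensity Λ a b c t f g x = B f g ∧
      |B f g| ≤ formBound d lam Λ * (‖f‖ * ‖g‖) := by
  let I1 : H1 U →L[ℝ] H1 U →L[ℝ] ℝ :=
    (innerSL ℝ).bilinearComp (gradL U) ((mulL (h.memLp_a ht)).comp (gradL U))
  let I2 : H1 U →L[ℝ] H1 U →L[ℝ] ℝ :=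
    (innerSL ℝ).bilinearComp (fnL U) ((mulL (h.memLp_b ht)).comp (gradL U))
  let I3 : H1 U →L[ℝ] H1 U →L[ℝ] ℝ :=
    (innerSL ℝ).bilinearComp (fnL U) ((mulL (h.memLp_c ht)).comp (fnL U))
  let I4 : H1 U →L[ℝ] H1 U →L[ℝ] ℝ := (innerSL ℝ).bilinearComp (fnL U) (fnL U)
  refine ⟨I1 - I2 - I3 + Λ • I4, fun f g => ?_⟩
  have e1 : I1 f g = ∫ x in U, inner ℝ (grad f x) (mulL (h.memLp_a ht) (grad g) x) :=
    L2.inner_def _ _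
  have e2 : I2 f g = ∫ x in U, inner ℝ (fn f x) (mulL (h.memLp_b ht) (grad g) x) :=
    L2.inner_def _ _
  have e3 : I3 f g = ∫ x in U, inner ℝ (fn f x) (mulL (h.memLp_c ht) (fn g) x) :=
    L2.inner_def _ _
  have e4 : I4 f g = ∫ x in U, inner ℝ (fn f x) (fn g x) := L2.inner_def _ _
  have i1 := L2.integrable_inner (𝕜 := ℝ) (grad f) (mulL (h.memLp_a ht) (grad g))
  have i2 := L2.integrable_inner (𝕜 := ℝ) (fn f) (mulL (h.memLp_b ht) (grad g))
  have i3 := L2.integrable_inner (𝕜 := ℝ) (fn f) (mulL (h.memLp_c ht) (fn g))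
  have i4 := L2.integrable_inner (𝕜 := ℝ) (fn f) (fn g)
  have hae : (fun x => inner ℝ (grad f x) (mulL (h.memLp_a ht) (grad g) x)
      - inner ℝ (fn f x) (mulL (h.memLp_b ht) (grad g) x)
      - inner ℝ (fn f x) (mulL (h.memLp_c ht) (fn g) x)
      + Λ * inner ℝ (fn f x) (fn g x)) =ᵐ[volume.restrict U] formDensity Λ a b c t f g := by
    filter_upwards [coeFn_mulL (h.memLp_a ht) (grad g), coeFn_mulL (h.memLp_b ht) (grad g),
      coeFn_mulL (h.memLp_c ht) (fn g)] with x h1 h2 h3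
    rw [h1, h2, h3]
    simp only [formDensity, LinearMap.coe_toContinuousLinearMap', innerSL_apply_apply,
      smul_eq_mul, smul_apply, ContinuousLinearMap.id_apply, RCLike.inner_apply,
      conj_trivial]
    ring
  refine ⟨(((i1.sub i2).sub i3).add (i4.const_mul Λ)).congr hae, ?_, ?_⟩
  swap
  · have hS : 0 ≤ ∑ i, ∑ j, lam * ‖(matrixUnit i j : E d →L[ℝ] E d)‖ :=
      Finset.sum_nonneg fun i _ => Finset.sum_nonneg fun j _ => by positivity
    have a1 : |I1 f g| ≤ _ := abs_inner_le_of_norm_le (norm_grad_le f)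
      ((norm_mulL_le (h.memLp_a ht) ht.norm_a_le _).trans
        (mul_le_mul_of_nonneg_left (norm_grad_le g) hS))
    have a2 : |I2 f g| ≤ _ := abs_inner_le_of_norm_le (norm_fn_le f)
      ((norm_mulL_le (h.memLp_b ht) ht.norm_b_le _).trans
        (mul_le_mul_of_nonneg_left (norm_grad_le g) (Real.sqrt_nonneg _)))
    have a3 : |I3 f g| ≤ _ := abs_inner_le_of_norm_le (norm_fn_le f)
      ((norm_mulL_le (h.memLp_c ht) ht.norm_c_le _).trans
        (mul_le_mul_of_nonneg_left (norm_fn_le g) (Real.sqrt_nonneg _)))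
    have a4 : |I4 f g| ≤ 1 * (‖f‖ * ‖g‖) := abs_inner_le_of_norm_le (norm_fn_le f)
      ((norm_fn_le g).trans_eq (one_mul _).symm)
    have a4' := mul_le_mul_of_nonneg_left a4 hΛ
    rw [← abs_of_nonneg hΛ, ← abs_mul, abs_of_nonneg hΛ] at a4'
    change |I1 f g - I2 f g - I3 f g + Λ * I4 f g| ≤ _
    rw [abs_le] at a1 a2 a3 a4' ⊢
    unfold formBound
    constructor <;> linarith [a1.1, a1.2, a2.1, a2.2, a3.1, a3.2, a4'.1, a4'.2]
  rw [← integral_congr_ae hae, integral_add (by exact (i1.sub i2).sub i3) (i4.const_mul Λ),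
    integral_sub (by exact i1.sub i2) i3, integral_sub i1 i2, integral_const_mul, ← e1, ← e2, ← e3, ← e4]
  rfl

theorem measurable_toEuclideanLin {α : Type*} [MeasurableSpace α]
    {m : α → Matrix (Fin d) (Fin d) ℝ} (hm : ∀ i j, Measurable fun z => m z i j) {y : α → E d}
    (hy : Measurable y) : Measurable fun z => Matrix.toEuclideanLin (m z) (y z) := by
  have : (fun z => Matrix.toEuclideanLin (m z) (y z)) =
      fun z => ∑ i, ∑ j, m z i j • (matrixUnit i j : E d →L[ℝ] E d) (y z) := by
    ext1 z
    have := congrArg (fun L : E d →L[ℝ] E d => L (y z)) (toEuclideanLin_eq_sum (m z))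
    simpa using! this
  rw [this]
  exact Finset.measurable_fun_sum _ fun i _ => Finset.measurable_fun_sum _ fun j _ =>
    (hm i j).smul ((matrixUnit i j).continuous.measurable.comp hy)

theorem IsAdmissible.stronglyMeasurable_form (h : IsAdmissible lam Λ a b c) (f g : H1 U) :
    StronglyMeasurable fun t => ∫ x in U, formDensity Λ a b c t f g x := by
  have hf : Measurable fun z : ℝ × E d => fn f z.2 :=
    (Lp.stronglyMeasurable (fn f)).measurable.comp measurable_snd
  have hg : Measurable fun z : ℝ × E d => fn g z.2 :=
    (Lp.stronglyMeasurable (fn g)).measurable.comp measurable_snd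
  have hf' : Measurable fun z : ℝ × E d => grad f z.2 :=
    (Lp.stronglyMeasurable (grad f)).measurable.comp measurable_snd
  have hg' : Measurable fun z : ℝ × E d => grad g z.2 :=
    (Lp.stronglyMeasurable (grad g)).measurable.comp measurable_snd
  have hb : Measurable fun z : ℝ × E d => b (z.2, z.1) := h.measurable_b.comp measurable_swap
  have hc : Measurable fun z : ℝ × E d => c (z.2, z.1) := h.measurable_c.comp measurable_swap
  have ha : Measurable fun z : ℝ × E d =>
      Matrix.toEuclideanLin (a (z.2, z.1)) (grad g z.2) :=
    measurable_toEuclideanLin (fun i j => (h.measurable_a i j).comp measurable_swap) hg'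
  have hm : Measurable fun z : ℝ × E d => formDensity Λ a b c z.1 f g z.2 :=
    (((hf'.inner ha).sub (hf.mul (hb.inner hg'))).sub ((hc.mul hg).mul hf)).add
      ((measurable_const.mul hg).mul hf)
  exact hm.stronglyMeasurable.integral_prod_right'

theorem secondCountableTopology_H1 (U : Set (E d)) : SecondCountableTopology (H1 U) := by
  have : Fact ((2 : ℝ≥0∞) ≠ ⊤) := ⟨by simp⟩
  have h1 : SecondCountableTopology (Lp ℝ 2 (volume.restrict U)) := inferInstance
  have h2 : SecondCountableTopology (Lp (E d) 2 (volume.restrict U)) := inferInstance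
  have h3 : IsInducing (toPair U) := IsInducing.subtypeVal
  exact ((WithLp.prodContinuousLinearEquiv 2 ℝ (Lp ℝ 2 (volume.restrict U))
    (Lp (E d) 2 (volume.restrict U))).toHomeomorph.isInducing.comp h3).secondCountableTopology

/-- The form along a measurable curve in `H¹(U)` is measurable: it is continuous in the curve for
fixed time, and measurable in time for a fixed pair of functions. -/
theorem IsAdmissible.aestronglyMeasurable_form (hlam : 0 ≤ lam) (hΛ : 0 ≤ Λ) (h : IsAdmissible lam Λ a b c)
    {μ : Measure ℝ} (hμ : μ ≪ volume) (M : H1 U →L[ℝ] H1 U) {v : ℝ → H1 U}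
    (hv : AEStronglyMeasurable v μ) :
    AEStronglyMeasurable (fun t => ∫ x in U, formDensity Λ a b c t (M (v t)) (v t) x) μ := by
  classical
  borelize (H1 U)
  have : SecondCountableTopology (H1 U) := secondCountableTopology_H1 U
  set N : Set ℝ := toMeasurable volume {t | ¬ IsAdmissibleSlice lam Λ a b c t}
  have hN : MeasurableSet N := measurableSet_toMeasurable _ _
  have hN0 : volume N = 0 := (measure_toMeasurable _).trans (h.ae_slice hΛ)
  have hgood : ∀ t ∉ N, IsAdmissibleSlice lam Λ a b c t := fun t ht => by
    by_contra hc
    exact ht (subset_toMeasurable _ _ hc)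
  let u : H1 U → ℝ → ℝ := fun f => Nᶜ.indicator fun t =>
    ∫ x in U, formDensity Λ a b c t (M f) f x
  have hu : StronglyMeasurable (Function.uncurry u) := by
    refine stronglyMeasurable_uncurry_of_continuous_of_stronglyMeasurable (fun t => ?_)
      fun f => (h.stronglyMeasurable_form (M f) f).indicator hN.compl
    by_cases ht : t ∈ N
    · have : (fun f => u f t) = fun _ => 0 :=
        funext fun f => indicator_of_notMem (by simpa using ht) _
      rw [this]
      exact continuous_const
    · obtain ⟨B, hB⟩ := h.exists_bilin hlam hΛ (hgood t ht) U
      have : (fun f => u f t) = fun f => B (M f) f :=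
        funext fun f => (indicator_of_mem (show t ∈ Nᶜ from ht) _).trans (hB (M f) f).2.1
      rw [this]
      fun_prop
  refine ⟨fun t => u (hv.mk v t) t,
    hu.comp_measurable (hv.stronglyMeasurable_mk.measurable.prodMk measurable_id), ?_⟩
  filter_upwards [hv.ae_eq_mk, hμ.ae_le (measure_eq_zero_iff_ae_notMem.1 hN0)] with t h1 h2
  rw [← h1]
  change _ = Nᶜ.indicator (fun s => ∫ x in U, formDensity Λ a b c s (M (v t)) (v t) x) t
  rw [indicator_of_mem (show t ∈ Nᶜ from h2)]

end Slice

/-- The pointwise Caccioppoli inequality. The mixed term of the diffusion is absorbed by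
positivity of the form at `z g + 2 w p`, the drift by `Λ w²`. -/
theorem pointwise_lower_bound {lam Λ z w c : ℝ} {m : Matrix (Fin d) (Fin d) ℝ} {b g p : E d}
    (hm : m.IsSymm) (h : ∀ ξ : E d, ‖ξ‖ ^ 2 ≤ inner ℝ ξ (Matrix.toEuclideanLin m ξ) ∧
      inner ℝ ξ (Matrix.toEuclideanLin m ξ) ≤ lam * ‖ξ‖ ^ 2)
    (hb : ‖b‖ ^ 2 ≤ Λ) (hc : c ≤ 0) :
    (1 / 4) * ‖z • g‖ ^ 2 - 2 * lam * ‖w • p‖ ^ 2 ≤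
      inner ℝ ((z * z) • g + w • (z • p + z • p)) (Matrix.toEuclideanLin m g)
        - z * z * w * inner ℝ b g - c * w * (z * z * w) + Λ * w * (z * z * w) := by
  set T := Matrix.toEuclideanLin m
  have hsym : inner ℝ g (T p) = inner ℝ p (T g) := by
    have hT : T.IsSymmetric := Matrix.isSymmetric_toEuclideanLin_iff.2
      (by rw [Matrix.IsHermitian, Matrix.conjTranspose_eq_transpose_of_trivial]; exact hm)
    rw [← hT g p, real_inner_comm]
  have h1 := (sq_nonneg _).trans (h (z • g + (2 * w) • p)).1
  have h2 := (h g).1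
  have h3 := (h p).2
  have hdrift : w * inner ℝ b g ≤ (1 / 4) * ‖g‖ ^ 2 + Λ * w ^ 2 := by
    have ha : w * inner ℝ b g ≤ |w| * (‖b‖ * ‖g‖) := by
      refine (le_abs_self _).trans ?_
      rw [abs_mul]
      exact mul_le_mul_of_nonneg_left (abs_real_inner_le_norm _ _) (abs_nonneg _)
    have hb' : ‖b‖ ^ 2 * w ^ 2 ≤ Λ * w ^ 2 := mul_le_mul_of_nonneg_right hb (sq_nonneg _)
    have hs := sq_nonneg ((1 / 2) * ‖g‖ - |w| * ‖b‖)
    nlinarith [sq_abs w]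
  simp only [map_add, map_smul, inner_add_left, inner_add_right, real_inner_smul_left,
    real_inner_smul_right, hsym] at h1 ⊢
  rw [norm_smul, norm_smul, mul_pow, mul_pow, Real.norm_eq_abs, Real.norm_eq_abs, sq_abs, sq_abs]
  have hz : 0 ≤ z ^ 2 := sq_nonneg z
  have k1 := mul_le_mul_of_nonneg_left h2 hz
  have k2 := mul_le_mul_of_nonneg_left h3 (sq_nonneg w)
  have k3 := mul_le_mul_of_nonneg_left hdrift hz
  have k4 : 0 ≤ -c * (w ^ 2 * z ^ 2) := mul_nonneg (by linarith) (by positivity)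
  nlinarith

/-- `f ↦ χ ∇f` from `H¹(U)` to `L²(U; ℝ^d)`. -/
def cutGrad (U : Set (E d)) {χ : E d → ℝ} (hχ : IsTest W χ) :
    H1 U →L[ℝ] Lp (E d) 2 (volume.restrict U) := (mulFn U (E d) hχ).comp (gradL U)

/-- `f ↦ f ∇χ` from `H¹(U)` to `L²(U; ℝ^d)`. -/
def gradCut (U : Set (E d)) {χ : E d → ℝ} (hχ : IsTest W χ) :
    H1 U →L[ℝ] Lp (E d) 2 (volume.restrict U) := (mulGrad U hχ).comp (fnL U)

/-- The Caccioppoli inequality at a fixed time. -/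
theorem IsAdmissible.form_lower_bound {lam Λ : ℝ} (hlam : 0 ≤ lam) (hΛ : 0 ≤ Λ)
    {a : E d × ℝ → Matrix (Fin d) (Fin d) ℝ}
    {b : E d × ℝ → E d} {c : E d × ℝ → ℝ} (h : IsAdmissible lam Λ a b c) {t : ℝ}
    (ht : IsAdmissibleSlice lam Λ a b c t) {χ : E d → ℝ} (hχ : IsTest W χ) (f : H1 U) :
    (1 / 4) * ‖cutGrad U hχ f‖ ^ 2 - 2 * lam * ‖gradCut U hχ f‖ ^ 2 ≤
      ∫ x in U, formDensity Λ a b c t (mulH1 U hχ.sq f) f x := by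
  obtain ⟨B, hB⟩ := h.exists_bilin hlam hΛ ht U
  rw [norm_sq_eq_integral, norm_sq_eq_integral, ← integral_const_mul, ← integral_const_mul,
    ← integral_sub ((integrable_norm_sq _).const_mul _) ((integrable_norm_sq _).const_mul _)]
  refine integral_mono_ae (((integrable_norm_sq _).const_mul _).sub
    ((integrable_norm_sq _).const_mul _)) (hB _ _).1 ?_
  filter_upwards [ae_restrict_of_ae ht, coeFn_mulFn hχ (grad f), coeFn_mulGrad hχ (fn f),
    coeFn_mulFn hχ.sq (fn f), coeFn_mulFn hχ.sq (grad f),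
    coeFn_mulGrad hχ.sq (fn f), Lp.coeFn_add (mulFn U (E d) hχ.sq (grad f))
      (mulGrad U hχ.sq (fn f))] with x hx h1 h2 h3 h4 h5 h6
  have e1 : cutGrad U hχ f x = χ x • grad f x := h1
  have e2 : gradCut U hχ f x = fn f x • gradient χ x := h2
  rw [e1, e2, formDensity, fn_mulH1, grad_mulH1, h6, Pi.add_apply, h3, h4, h5,
    gradient_mul (hχ.differentiableAt x) (hχ.differentiableAt x), smul_eq_mul]
  exact pointwise_lower_bound hx.1 hx.2.1 hx.2.2.1 hx.2.2.2.1

/-- The `H¹` norm of `χ² f`, for `|χ| ≤ 1`. -/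
theorem norm_mulH1_sq_le {χ : E d → ℝ} (hχ : IsTest W χ) (h1 : ∀ x, |χ x| ≤ 1) (f : H1 U) :
    ‖mulH1 U hχ.sq f‖ ^ 2 ≤
      ‖cutFn U hχ f‖ ^ 2 + 2 * ‖cutGrad U hχ f‖ ^ 2 + 8 * ‖gradCut U hχ f‖ ^ 2 := by
  have e1 : mulFn U ℝ hχ.sq (fn f) = mulFn U ℝ hχ (cutFn U hχ f) := by
    refine Lp.ext ?_
    filter_upwards [coeFn_mulFn hχ.sq (fn f), coeFn_mulFn hχ (cutFn U hχ f),
      coeFn_mulFn hχ (fn f)] with x h1 h2 h3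
    have e : cutFn U hχ f x = χ x • fn f x := h3
    rw [h1, h2, e, mul_smul]
  have e2 : mulFn U (E d) hχ.sq (grad f) = mulFn U (E d) hχ (cutGrad U hχ f) := by
    refine Lp.ext ?_
    filter_upwards [coeFn_mulFn hχ.sq (grad f), coeFn_mulFn hχ (cutGrad U hχ f),
      coeFn_mulFn hχ (grad f)] with x h1 h2 h3
    have e : cutGrad U hχ f x = χ x • grad f x := h3
    rw [h1, h2, e, mul_smul]
  have e3 : mulGrad U hχ.sq (fn f) = (2 : ℝ) • mulFn U (E d) hχ (gradCut U hχ f) := by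
    refine Lp.ext ?_
    filter_upwards [coeFn_mulGrad hχ.sq (fn f), coeFn_mulFn hχ (gradCut U hχ f),
      coeFn_mulGrad hχ (fn f), Lp.coeFn_smul (2 : ℝ) (mulFn U (E d) hχ (gradCut U hχ f))]
      with x h1 h2 h3 h4
    have e : gradCut U hχ f x = fn f x • gradient χ x := h3
    rw [h1, h4, Pi.smul_apply, h2, e, gradient_mul (hχ.differentiableAt x) (hχ.differentiableAt x)]
    module
  have b1 : ‖fn (mulH1 U hχ.sq f)‖ ≤ ‖cutFn U hχ f‖ := by
    rw [fn_mulH1, e1]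
    exact norm_mulFn_le hχ h1 _
  have b2 : ‖grad (mulH1 U hχ.sq f)‖ ≤ ‖cutGrad U hχ f‖ + 2 * ‖gradCut U hχ f‖ := by
    rw [grad_mulH1, e2, e3]
    refine (norm_add_le _ _).trans (add_le_add (norm_mulFn_le hχ h1 _) ?_)
    rw [norm_smul, Real.norm_ofNat]
    exact mul_le_mul_of_nonneg_left (norm_mulFn_le hχ h1 _) (by norm_num)
  rw [H1.norm_sq]
  have c1 := pow_le_pow_left₀ (norm_nonneg _) b1 2
  have c2 := pow_le_pow_left₀ (norm_nonneg _) b2 2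
  nlinarith [sq_nonneg (‖cutGrad U hχ f‖ - 2 * ‖gradCut U hχ f‖)]

/-! ### Cutoff functions -/

theorem exists_cutoff (d : ℕ) : ∃ C > (0 : ℝ), ∀ r > (0 : ℝ), ∃ χ : E d → ℝ,
    IsTest (Metric.ball 0 (2 * r)) χ ∧ (∀ x, |χ x| ≤ 1) ∧ (∀ x ∈ Metric.ball 0 r, χ x = 1) ∧
      ∀ x, ‖gradient χ x‖ ≤ C * r⁻¹ := by
  let f : ContDiffBump (0 : E d) := ⟨1, 3 / 2, by norm_num, by norm_num⟩
  have hf : IsTest univ f := ⟨f.contDiff, f.hasCompactSupport, subset_univ _⟩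
  obtain ⟨C, hC⟩ := hf.exists_bound_gradient
  refine ⟨max C 1, by positivity, fun r hr => ⟨fun x => f (r⁻¹ • x), ?_, ?_, ?_, ?_⟩⟩
  · have hsupp : tsupport (fun x => f (r⁻¹ • x)) ⊆ Metric.closedBall 0 (3 / 2 * r) := by
      refine closure_minimal (fun x hx => ?_) Metric.isClosed_closedBall
      have h1 : r⁻¹ • x ∈ Function.support f := hx
      rw [f.support_eq, mem_ball_zero_iff, norm_smul, Real.norm_of_nonneg (by positivity)] at h1
      rw [mem_closedBall_zero_iff]
      have h2 := mul_le_mul_of_nonneg_right h1.le hr.le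
      rwa [mul_right_comm, inv_mul_cancel₀ hr.ne', one_mul] at h2
    refine ⟨f.contDiff.comp (contDiff_const_smul _), ?_, hsupp.trans
      (Metric.closedBall_subset_ball (by linarith))⟩
    exact (isCompact_closedBall _ _).of_isClosed_subset (isClosed_tsupport _) hsupp
  · intro x
    rw [abs_of_nonneg f.nonneg]
    exact f.le_one
  · intro x hx
    refine f.one_of_mem_closedBall ?_
    rw [mem_ball_zero_iff] at hx
    rw [mem_closedBall_zero_iff, norm_smul, Real.norm_of_nonneg (by positivity)]
    have h2 := mul_le_mul_of_nonneg_left hx.le (inv_nonneg.2 hr.le)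
    rwa [inv_mul_cancel₀ hr.ne'] at h2
  · intro x
    rw [norm_gradient, fderiv_comp_smul, norm_smul, Real.norm_of_nonneg (by positivity), mul_comm,
      ← norm_gradient]
    exact mul_le_mul_of_nonneg_right ((hC _).trans (le_max_left _ _)) (by positivity)

/-! ### The inequality integrated in time -/

theorem integrable_pairing {X : Type*} [NormedAddCommGroup X] [NormedSpace ℝ X] {μ : Measure ℝ}
    {F : ℝ → X →L[ℝ] ℝ} {w : ℝ → X} (hF : MemLp F 2 μ) (hw : MemLp w 2 μ) :
    Integrable (fun t => F t (w t)) μ :=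
  memLp_one_iff_integrable.1
    ((ContinuousLinearMap.id ℝ (X →L[ℝ] ℝ)).memLp_of_bilin 1 hF hw)

theorem memLp_restrictNeg {μ : Measure ℝ} (h : W ⊆ U) {H : ℝ → HNeg U U} (hH : MemLp H 2 μ) :
    MemLp (fun t => restrictNeg h (H t)) 2 μ :=
  ((ContinuousLinearMap.compL ℝ (H10 U W) (H10 U U) ℝ).flip (inclH10 h)).comp_memLp' hH

theorem integrable_form {lam Λ : ℝ} (hlam : 0 ≤ lam) (hΛ : 0 ≤ Λ)
    {a : E d × ℝ → Matrix (Fin d) (Fin d) ℝ}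
    {b : E d × ℝ → E d} {c : E d × ℝ → ℝ} (h : IsAdmissible lam Λ a b c) {S : Set ℝ}
    (M : H1 U →L[ℝ] H1 U) {v : ℝ → H1 U} (hv : MemLp v 2 (volume.restrict S)) :
    Integrable (fun t => ∫ x in U, formDensity Λ a b c t (M (v t)) (v t) x)
      (volume.restrict S) := by
  have hmaj : Integrable (fun t => formBound d lam Λ * (‖M (v t)‖ * ‖v t‖)) (volume.restrict S) :=
    (MemLp.integrable_mul (M.comp_memLp' hv).norm hv.norm).const_mul _
  refine hmaj.mono' (h.aestronglyMeasurable_form hlam hΛ Measure.restrict_le_self.absolutelyContinuous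
    M hv.1) ?_
  filter_upwards [ae_restrict_of_ae (h.ae_slice hΛ)] with t ht
  obtain ⟨B, hB⟩ := h.exists_bilin hlam hΛ ht U
  rw [(hB _ _).2.1]
  exact (hB _ _).2.2

/-- The equation tested with `(1 - t) χ² v` up to time `s`. -/
theorem IsWeakSolution.tested {lam Λ : ℝ} (hlam : 0 ≤ lam) (hΛ : 0 ≤ Λ)
    {a : E d × ℝ → Matrix (Fin d) (Fin d) ℝ}
    {b : E d × ℝ → E d} {c : E d × ℝ → ℝ} (h : IsAdmissible lam Λ a b c)
    {T₀ T₁ s : ℝ} (hT₀ : 0 ≤ T₀) (hsT : s ≤ T₁) (hs : s ≤ 1)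
    {H : ℝ → HNeg U U}
    {v : ℝ → H1 U} {v' : ℝ → HNeg U U} (hv : MemHParZero T₀ T₁ v v')
    (hw : IsWeakSolution T₀ T₁ Λ a b c H v v') {χ : E d → ℝ} (hχ : IsTest W χ) :
    (∫ t in Ioo T₀ s, (1 - t) * v' t (mulSq U hχ (toH10 (v t)))) +
      (∫ t in Ioo T₀ s, (1 - t) *
        ∫ x in U, formDensity Λ a b c t (mulH1 U hχ.sq (v t)) (v t) x) =
      ∫ t in Ioo T₀ s, (1 - t) * H t (mulSq U hχ (toH10 (v t))) := by
  have hsub : Ioo T₀ s ⊆ Ioo T₀ T₁ := Ioo_subset_Ioo_right hsT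
  have hμ : volume.restrict (Ioo T₀ s) ≤ volume.restrict (Ioo T₀ T₁) :=
    Measure.restrict_mono_set _ hsub
  set w : ℝ → H10 U U := fun t => mulSq U hχ (toH10 (v t)) with hwdef
  have hwL : MemLp w 2 (volume.restrict (Ioo T₀ T₁)) :=
    (mulSq U hχ).comp_memLp' (memLp_toH10 hv.memHPar.memLp hv.ae_mem)
  have hθ : ∀ᵐ t ∂volume.restrict (Ioo T₀ s), ‖(1 - t : ℝ)‖ ≤ 1 := by
    filter_upwards [ae_restrict_mem measurableSet_Ioo] with t ht
    rw [Real.norm_eq_abs, abs_le]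
    constructor <;> linarith [ht.1, ht.2]
  have hθm : AEStronglyMeasurable (fun t : ℝ => 1 - t) (volume.restrict (Ioo T₀ s)) :=
    (continuous_const.sub continuous_id).aestronglyMeasurable
  have hθw : MemLp (fun t => (1 - t) • w t) 2 (volume.restrict (Ioo T₀ s)) := by
    refine (hwL.mono_measure hμ).of_le (hθm.smul (hwL.mono_measure hμ).1) ?_
    filter_upwards [hθ] with t ht
    rw [norm_smul]
    exact mul_le_of_le_one_left (norm_nonneg _) ht
  set η : ℝ → H10 U U := (Ioo T₀ s).indicator fun t => (1 - t) • w t with hη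
  have hηL : MemLp η 2 (volume.restrict (Ioo T₀ T₁)) := by
    rw [hη, memLp_indicator_iff_restrict measurableSet_Ioo,
      Measure.restrict_restrict measurableSet_Ioo, inter_eq_left.2 hsub]
    exact hθw
  have key : ∫ t in Ioo T₀ T₁, (v' t (η t) +
      ∫ x in U, formDensity Λ a b c t (toH1 (η t)) (v t) x) = ∫ t in Ioo T₀ T₁, H t (η t) :=
    hw η hηL
  have hr : ∀ t, H t (η t) = (Ioo T₀ s).indicator (fun t => (1 - t) * H t (w t)) t := by
    intro t
    by_cases ht : t ∈ Ioo T₀ s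
    · rw [hη, indicator_of_mem ht, indicator_of_mem ht, map_smul, smul_eq_mul]
    · rw [hη, indicator_of_notMem ht, indicator_of_notMem ht, map_zero]
  have hl : ∀ᵐ t ∂volume.restrict (Ioo T₀ T₁), v' t (η t) +
      ∫ x in U, formDensity Λ a b c t (toH1 (η t)) (v t) x =
      (Ioo T₀ s).indicator (fun t => (1 - t) * v' t (w t) + (1 - t) *
        ∫ x in U, formDensity Λ a b c t (mulH1 U hχ.sq (v t)) (v t) x) t := by
    filter_upwards [ae_restrict_of_ae (h.ae_slice hΛ), hv.ae_mem] with t ht hm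
    obtain ⟨B, hB⟩ := h.exists_bilin hlam hΛ ht U
    rw [(hB _ _).2.1]
    by_cases ht : t ∈ Ioo T₀ s
    · rw [hη, indicator_of_mem ht, indicator_of_mem ht, (hB _ _).2.1, map_smul, map_smul, map_smul,
        hwdef, toH1_mulSq, toH1_toH10 hm]
      rfl
    · rw [hη, indicator_of_notMem ht, indicator_of_notMem ht]
      simp
  rw [integral_congr_ae hl, integral_congr_ae (.of_forall hr),
    setIntegral_indicator measurableSet_Ioo, setIntegral_indicator measurableSet_Ioo,
    inter_eq_right.2 hsub] at key
  rw [← key, integral_add]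
  · refine (integrable_pairing (hv.memHPar.memLp_deriv.mono_measure hμ) hθw).congr
      (.of_forall fun t => ?_)
    simp
  · exact (integrable_form hlam hΛ h (mulH1 U hχ.sq)
      (hv.memHPar.memLp.mono_measure hμ)).bdd_mul hθm hθ

/-- The Caccioppoli inequality with a cutoff function. The energy inequality and the lower bound of
the form are inserted in the tested equation, and the right-hand side is absorbed. -/
theorem IsWeakSolution.caccioppoli_cutoff {lam Λ : ℝ} (hlam : 0 ≤ lam) (hΛ : 0 ≤ Λ)
    {a : E d × ℝ → Matrix (Fin d) (Fin d) ℝ}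
    {b : E d × ℝ → E d} {c : E d × ℝ → ℝ} (h : IsAdmissible lam Λ a b c)
    {T₀ T₁ s : ℝ} (hT₀ : 0 ≤ T₀) (hsT : s ≤ T₁) (hs : s ≤ 1 / 4)
    {H : ℝ → HNeg U U} (hH : MemLp H 2 (volume.restrict (Ioo T₀ T₁)))
    {v : ℝ → H1 U} {v' : ℝ → HNeg U U} (hv : MemHParZero T₀ T₁ v v')
    (hw : IsWeakSolution T₀ T₁ Λ a b c H v v') {χ : E d → ℝ} (hχ : IsTest W χ)
    (hχ1 : ∀ x, |χ x| ≤ 1) :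
    ∫ t in Ioo T₀ s, ‖cutGrad U hχ (v t)‖ ^ 2 ≤
      (16 * lam + 2) * (∫ t in Ioo T₀ s, ‖gradCut U hχ (v t)‖ ^ 2) +
      64 * ∫ t in Ioo T₀ s, ‖restrictNeg (inter_subset_right : W ∩ U ⊆ U) (H t)‖ ^ 2 := by
  have hμ : volume.restrict (Ioo T₀ s) ≤ volume.restrict (Ioo T₀ T₁) :=
    Measure.restrict_mono_set _ (Ioo_subset_Ioo_right hsT)
  have hs1 : s ≤ 1 := by linarith
  have henergy := hv.energy hT₀ hsT hs1 hχ
  have heq := hw.tested hlam hΛ h hT₀ hsT hs1 hv hχ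
  set μ := volume.restrict (Ioo T₀ s) with hμdef
  have hvL := hv.memHPar.memLp.mono_measure hμ
  have hmem := ae_mono hμ hv.ae_mem
  have hHL := hH.mono_measure hμ
  have iN : Integrable (fun t => ‖cutFn U hχ (v t)‖ ^ 2) μ :=
    ((cutFn U hχ).comp_memLp' hvL).integrable_norm_pow (by norm_num)
  have iG : Integrable (fun t => ‖cutGrad U hχ (v t)‖ ^ 2) μ :=
    ((cutGrad U hχ).comp_memLp' hvL).integrable_norm_pow (by norm_num)
  have iK : Integrable (fun t => ‖gradCut U hχ (v t)‖ ^ 2) μ :=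
    ((gradCut U hχ).comp_memLp' hvL).integrable_norm_pow (by norm_num)
  have iH : Integrable (fun t => ‖restrictNeg (inter_subset_right : W ∩ U ⊆ U) (H t)‖ ^ 2) μ :=
    (memLp_restrictNeg _ hHL).integrable_norm_pow (by norm_num)
  have hθm : AEStronglyMeasurable (fun t : ℝ => 1 - t) μ :=
    (continuous_const.sub continuous_id).aestronglyMeasurable
  have htime : ∀ᵐ t ∂μ, 3 / 4 ≤ 1 - t ∧ 1 - t ≤ 1 := by
    filter_upwards [ae_restrict_mem measurableSet_Ioo] with t ht
    constructor <;> linarith [ht.1, ht.2]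
  have hθ : ∀ᵐ t ∂μ, ‖(1 - t : ℝ)‖ ≤ 1 := by
    filter_upwards [htime] with t ht
    rw [Real.norm_eq_abs, abs_le]
    constructor <;> linarith [ht.1, ht.2]
  -- `1 - t` lies between `3 / 4` and `1`, which turns `1 / 4` into `3 / 16`.
  have hform : (3 / 16) * (∫ t, ‖cutGrad U hχ (v t)‖ ^ 2 ∂μ) -
      2 * lam * (∫ t, ‖gradCut U hχ (v t)‖ ^ 2 ∂μ) ≤ ∫ t, (1 - t) *
        (∫ x in U, formDensity Λ a b c t (mulH1 U hχ.sq (v t)) (v t) x) ∂μ := by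
    rw [← integral_const_mul, ← integral_const_mul,
      ← integral_sub (iG.const_mul _) (iK.const_mul _)]
    refine integral_mono_ae ((iG.const_mul _).sub (iK.const_mul _))
      ((integrable_form hlam hΛ h (mulH1 U hχ.sq) hvL).bdd_mul hθm hθ) ?_
    filter_upwards [ae_restrict_of_ae (h.ae_slice hΛ), htime] with t ht htt
    have h1 := h.form_lower_bound hlam hΛ ht hχ (v t)
    have h2 := mul_le_mul_of_nonneg_left h1 (by linarith [htt.1] : 0 ≤ 1 - t)
    refine le_trans ?_ h2
    have hG := sq_nonneg ‖cutGrad U hχ (v t)‖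
    have hK := mul_nonneg hlam (sq_nonneg ‖gradCut U hχ (v t)‖)
    nlinarith [mul_nonneg (sub_nonneg.2 htt.1) hG, mul_nonneg (sub_nonneg.2 htt.2) hK]
  -- Young's inequality with weights `8` and `1 / 32`: the multiples `1 / 32` and `1 / 16` of the
  -- integrals of `‖χ v‖²` and `‖χ ∇v‖²` are smaller than the `1 / 2` and `3 / 16` available.
  have hrhs : ∫ t, (1 - t) * H t (mulSq U hχ (toH10 (v t))) ∂μ ≤
      8 * (∫ t, ‖restrictNeg (inter_subset_right : W ∩ U ⊆ U) (H t)‖ ^ 2 ∂μ) +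
      ((1 / 32) * (∫ t, ‖cutFn U hχ (v t)‖ ^ 2 ∂μ) + (1 / 16) * (∫ t, ‖cutGrad U hχ (v t)‖ ^ 2 ∂μ)
        + (1 / 4) * (∫ t, ‖gradCut U hχ (v t)‖ ^ 2 ∂μ)) := by
    have iNG : Integrable (fun t => (1 / 32) * ‖cutFn U hχ (v t)‖ ^ 2 +
        (1 / 16) * ‖cutGrad U hχ (v t)‖ ^ 2) μ := (iN.const_mul _).add (iG.const_mul _)
    have iNGK : Integrable (fun t => (1 / 32) * ‖cutFn U hχ (v t)‖ ^ 2 +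
        (1 / 16) * ‖cutGrad U hχ (v t)‖ ^ 2 + (1 / 4) * ‖gradCut U hχ (v t)‖ ^ 2) μ :=
      iNG.add (iK.const_mul _)
    rw [← integral_const_mul, ← integral_const_mul, ← integral_const_mul, ← integral_const_mul,
      ← integral_add (iN.const_mul _) (iG.const_mul _), ← integral_add iNG (iK.const_mul _),
      ← integral_add (iH.const_mul _) iNGK]
    refine integral_mono_ae
      ((integrable_pairing hHL ((mulSq U hχ).comp_memLp' (memLp_toH10 hvL hmem))).bdd_mul hθm hθ)
      ((iH.const_mul _).add iNGK) ?_
    filter_upwards [hmem, hθ] with t hm ht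
    have e1 : |H t (mulSq U hχ (toH10 (v t)))| ≤
        ‖restrictNeg (inter_subset_right : W ∩ U ⊆ U) (H t)‖ * ‖mulH1 U hχ.sq (v t)‖ := by
      have := (restrictNeg (inter_subset_right : W ∩ U ⊆ U) (H t)).le_opNorm
        (mulH10 U hχ.sq (toH10 (v t)))
      rwa [← norm_toH1 (mulH10 U hχ.sq (toH10 (v t))), toH1_mulH10, toH1_toH10 hm] at this
    have e2 : (1 - t) * H t (mulSq U hχ (toH10 (v t))) ≤ |H t (mulSq U hχ (toH10 (v t)))| := by
      refine (le_abs_self _).trans ?_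
      rw [abs_mul]
      exact mul_le_of_le_one_left (abs_nonneg _) ht
    have e3 := norm_mulH1_sq_le hχ hχ1 (v t)
    have e4 := sq_nonneg (16 * ‖restrictNeg (inter_subset_right : W ∩ U ⊆ U) (H t)‖ -
      ‖mulH1 U hχ.sq (v t)‖)
    nlinarith
  have hN0 : 0 ≤ ∫ t, ‖cutFn U hχ (v t)‖ ^ 2 ∂μ := integral_nonneg fun t => sq_nonneg _
  linarith

/-! ### Space-time norms -/

theorem ofReal_integral_norm_sq {X : Type*} [NormedAddCommGroup X] {μ : Measure ℝ} {f : ℝ → X}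
    (hf : MemLp f 2 μ) : ENNReal.ofReal (∫ t, ‖f t‖ ^ 2 ∂μ) = ∫⁻ t, ‖f t‖ₑ ^ 2 ∂μ := by
  rw [ofReal_integral_eq_lintegral_ofReal (hf.integrable_norm_pow (by norm_num))
    (.of_forall fun t => sq_nonneg _)]
  refine lintegral_congr fun t => ?_
  rw [ENNReal.ofReal_pow (norm_nonneg _), ofReal_norm]

theorem eLpNorm_two_eq {α X : Type*} [MeasurableSpace α] [NormedAddCommGroup X] {μ : Measure α}
    (f : α → X) : eLpNorm f 2 μ = (∫⁻ t, ‖f t‖ₑ ^ 2 ∂μ) ^ (1 / 2 : ℝ) := by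
  rw [eLpNorm_eq_lintegral_rpow_enorm_toReal (by norm_num) (by norm_num)]
  simp

/-- The square of the space-time norm over `Q r ∩ U × I`. -/
def cylinderEnergy {X : Type*} [NormedAddCommGroup X] (T₀ T₁ r : ℝ)
    (F : ℝ → Lp X 2 (volume.restrict U)) : ℝ≥0∞ :=
  ∫⁻ t in Ioc 0 (r ^ 2) ∩ Ioo T₀ T₁, ∫⁻ x in Metric.ball 0 r ∩ U, ‖F t x‖ₑ ^ 2

theorem spaceTimeNorm_cylinder {X : Type*} [NormedAddCommGroup X] (T₀ T₁ r : ℝ)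
    (F : ℝ → Lp X 2 (volume.restrict U)) :
    spaceTimeNorm (Q r ∩ U ×ˢ Ioo T₀ T₁) F = cylinderEnergy T₀ T₁ r F ^ (1 / 2 : ℝ) := by
  unfold spaceTimeNorm cylinderEnergy
  congr 1
  rw [← lintegral_indicator (measurableSet_Ioc.inter measurableSet_Ioo)]
  refine lintegral_congr fun t => ?_
  by_cases ht : t ∈ Ioc 0 (r ^ 2) ∩ Ioo T₀ T₁
  · rw [indicator_of_mem ht]
    congr 2
    ext x
    simp only [Q, mem_ofPred_eq, mem_inter_iff, mem_prod]
    exact ⟨fun h => ⟨h.1.1, h.2.1⟩, fun h => ⟨⟨h.1, ht.1⟩, h.2, ht.2⟩⟩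
  · rw [indicator_of_notMem ht]
    have : {x | (x, t) ∈ Q r ∩ U ×ˢ Ioo T₀ T₁} = ∅ := by
      ext x
      simp only [Q, mem_ofPred_eq, mem_inter_iff, mem_prod, mem_empty_iff_false, iff_false]
      exact fun h => ht ⟨h.1.2, h.2.2⟩
    rw [this]
    simp

theorem cylinderEnergy_grad_le {χ : E d → ℝ} (hχ : IsTest W χ) {r : ℝ}
    (h1 : ∀ x ∈ Metric.ball 0 r, χ x = 1) (T₀ T₁ : ℝ) (v : ℝ → H1 U) :
    cylinderEnergy T₀ T₁ r (fun t => grad (v t)) ≤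
      ∫⁻ t in Ioo T₀ (min (r ^ 2) T₁), ‖cutGrad U hχ (v t)‖ₑ ^ 2 := by
  rw [setLIntegral_congr Ioo_ae_eq_Ioc]
  refine (lintegral_mono_set (t := Ioc T₀ (min (r ^ 2) T₁)) fun t ht =>
    ⟨ht.2.1, le_min ht.1.2 ht.2.2.le⟩).trans (lintegral_mono fun t => ?_)
  rw [enorm_sq_eq_lintegral, ← Measure.restrict_restrict measurableSet_ball]
  refine le_trans (lintegral_mono_ae ?_) (setLIntegral_le_lintegral (Metric.ball 0 r) _)
  filter_upwards [ae_restrict_of_ae (coeFn_mulFn hχ (grad (v t))),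
    ae_restrict_mem measurableSet_ball] with x hx hxb
  have e : cutGrad U hχ (v t) x = χ x • grad (v t) x := hx
  rw [e, h1 x hxb, one_smul]

theorem Ioo_min_subset {T₀ : ℝ} (hT₀ : 0 ≤ T₀) (T₁ r : ℝ) :
    Ioo T₀ (min (r ^ 2) T₁) ⊆ Ioc 0 ((2 * r) ^ 2) ∩ Ioo T₀ T₁ := by
  intro t ht
  have h1 := (lt_min_iff.1 ht.2).1
  refine ⟨⟨hT₀.trans_lt ht.1, ?_⟩, ht.1, (lt_min_iff.1 ht.2).2⟩
  nlinarith [sq_nonneg r]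

theorem lintegral_gradCut_le {χ : E d → ℝ} {r : ℝ}
    (hχ : IsTest (Metric.ball 0 (2 * r)) χ) {C : ℝ} (hC : ∀ x, ‖gradient χ x‖ ≤ C)
    {T₀ : ℝ} (hT₀ : 0 ≤ T₀) (T₁ : ℝ) (v : ℝ → H1 U) :
    ∫⁻ t in Ioo T₀ (min (r ^ 2) T₁), ‖gradCut U hχ (v t)‖ₑ ^ 2 ≤
      ENNReal.ofReal C ^ 2 * cylinderEnergy T₀ T₁ (2 * r) (fun t => fn (v t)) := by
  unfold cylinderEnergy
  rw [← lintegral_const_mul' _ _ (by finiteness)]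
  refine (lintegral_mono fun t => ?_).trans (lintegral_mono_set (Ioo_min_subset hT₀ T₁ r))
  rw [enorm_sq_eq_lintegral, ← lintegral_const_mul' _ _ (by finiteness),
    ← Measure.restrict_restrict measurableSet_ball, ← lintegral_indicator measurableSet_ball]
  refine lintegral_mono_ae ?_
  filter_upwards [coeFn_mulGrad hχ (fn (v t))] with x hx
  have e : gradCut U hχ (v t) x = fn (v t) x • gradient χ x := hx
  rw [e]
  by_cases hxb : x ∈ Metric.ball 0 (2 * r)
  · rw [indicator_of_mem hxb, enorm_smul, mul_pow, mul_comm]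
    gcongr
    rw [← ofReal_norm]
    exact ENNReal.ofReal_le_ofReal (hC x)
  · have h0 : gradient χ x = 0 := by
      rw [gradient, fderiv_of_notMem_tsupport (𝕜 := ℝ) fun hx => hxb (hχ.2.2 hx), map_zero]
    rw [indicator_of_notMem hxb, h0]
    simp

end ParabolicCaccioppoli

open ParabolicCaccioppoli in
theorem mainTheorem5 (d : ℕ) (lam : ℝ) (hlam : 1 < lam)
    (U : Set (ParabolicCaccioppoli.E d))
    (hU : ParabolicCaccioppoli.IsBoundedLipschitzDomain U)
    (hU1 : U ⊆ Metric.ball 0 1)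
    (T₀ T₁ : ℝ) (hT : T₀ < T₁) (hI : Ioo T₀ T₁ ⊆ Ioo (0 : ℝ) (1 / 4)) :
    ∃ C : ℝ, 0 < C ∧
      ∀ (Λ : ℝ), 0 < Λ →
      ∀ (a : ParabolicCaccioppoli.E d × ℝ → Matrix (Fin d) (Fin d) ℝ)
        (b : ParabolicCaccioppoli.E d × ℝ → ParabolicCaccioppoli.E d)
        (c : ParabolicCaccioppoli.E d × ℝ → ℝ),
        ParabolicCaccioppoli.IsAdmissible lam Λ a b c →
      ∀ H : ℝ → ParabolicCaccioppoli.HNeg U U,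
        MemLp H 2 (volume.restrict (Ioo T₀ T₁)) →
      ∀ (v : ℝ → ParabolicCaccioppoli.H1 U) (v' : ℝ → ParabolicCaccioppoli.HNeg U U),
        ParabolicCaccioppoli.MemHParZero T₀ T₁ v v' →
        ParabolicCaccioppoli.IsWeakSolution T₀ T₁ Λ a b c H v v' →
      ∀ r : ℝ, 0 < r →
        ParabolicCaccioppoli.spaceTimeNorm (ParabolicCaccioppoli.Q r ∩ U ×ˢ Ioo T₀ T₁)
            (fun t => ParabolicCaccioppoli.grad (v t)) ≤
          ENNReal.ofReal C *
            (ENNReal.ofReal r⁻¹ *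
                ParabolicCaccioppoli.spaceTimeNorm
                  (ParabolicCaccioppoli.Q (2 * r) ∩ U ×ˢ Ioo T₀ T₁) (fun t => ParabolicCaccioppoli.fn (v t))
              + eLpNorm
                  (fun t => ParabolicCaccioppoli.restrictNeg
                    (Set.inter_subset_right : Metric.ball 0 (2 * r) ∩ U ⊆ U) (H t)) 2
                  (volume.restrict (Ioc 0 ((2 * r) ^ 2) ∩ Ioo T₀ T₁))) := by
  have hT₀ : 0 ≤ T₀ := ((Ioo_subset_Ioo_iff hT).1 hI).1
  have hT₁ : T₁ ≤ 1 / 4 := ((Ioo_subset_Ioo_iff hT).1 hI).2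
  obtain ⟨κ, hκ, hcut⟩ := exists_cutoff d
  refine ⟨(16 * lam + 2) * κ + 8, by positivity, ?_⟩
  intro Λ hΛ a b c hadm H hH v v' hv hw r hr
  obtain ⟨χ, hχ, hχ1, hχr, hχg⟩ := hcut r hr
  have hlam0 : 0 ≤ lam := by linarith
  set s : ℝ := min (r ^ 2) T₁ with hs
  have hsT : s ≤ T₁ := min_le_right _ _
  have hμ : volume.restrict (Ioo T₀ s) ≤ volume.restrict (Ioo T₀ T₁) :=
    Measure.restrict_mono_set _ (Ioo_subset_Ioo_right hsT)
  have hvL := hv.memHPar.memLp.mono_measure hμ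
  have hreal := hw.caccioppoli_cutoff hlam0 hΛ.le hadm hT₀ hsT (hsT.trans hT₁) hH hv hχ hχ1
  set Hr : ℝ → HNeg U (Metric.ball 0 (2 * r) ∩ U) := fun t =>
    restrictNeg (inter_subset_right : Metric.ball 0 (2 * r) ∩ U ⊆ U) (H t) with hHr
  have hHrL : MemLp Hr 2 (volume.restrict (Ioo T₀ s)) :=
    memLp_restrictNeg _ (hH.mono_measure hμ)
  have hG : MemLp (fun t => cutGrad U hχ (v t)) 2 (volume.restrict (Ioo T₀ s)) :=
    (cutGrad U hχ).comp_memLp' hvL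
  have hK : MemLp (fun t => gradCut U hχ (v t)) 2 (volume.restrict (Ioo T₀ s)) :=
    (gradCut U hχ).comp_memLp' hvL
  have hE := ENNReal.ofReal_le_ofReal hreal
  rw [ENNReal.ofReal_add (by positivity) (by positivity), ENNReal.ofReal_mul (by positivity),
    ENNReal.ofReal_mul (by positivity),
    ofReal_integral_norm_sq hG,
    ofReal_integral_norm_sq hK,
    ofReal_integral_norm_sq hHrL] at hE
  rw [spaceTimeNorm_cylinder, spaceTimeNorm_cylinder, eLpNorm_two_eq]
  set X := cylinderEnergy T₀ T₁ r (fun t => grad (v t))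
  set Y := cylinderEnergy T₀ T₁ (2 * r) (fun t => fn (v t))
  set Z := ∫⁻ t in Ioc 0 ((2 * r) ^ 2) ∩ Ioo T₀ T₁, ‖Hr t‖ₑ ^ 2
  set C : ℝ := (16 * lam + 2) * κ + 8 with hC
  have hA : 1 ≤ 16 * lam + 2 := by linarith
  have hXYZ : X ≤ (ENNReal.ofReal C * ENNReal.ofReal r⁻¹) ^ 2 * Y + ENNReal.ofReal C ^ 2 * Z := by
    refine (cylinderEnergy_grad_le hχ hχr T₀ T₁ v).trans (hE.trans (add_le_add ?_ ?_))
    · refine (mul_le_mul_right (lintegral_gradCut_le hχ hχg hT₀ T₁ v) _).trans ?_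
      rw [← mul_assoc, ← ENNReal.ofReal_pow (by positivity), ← ENNReal.ofReal_mul (by positivity),
        ← ENNReal.ofReal_mul (by positivity), ← ENNReal.ofReal_pow (by positivity)]
      refine mul_le_mul_left (ENNReal.ofReal_le_ofReal ?_) _
      rw [mul_pow, mul_pow, ← mul_assoc]
      refine mul_le_mul_of_nonneg_right ?_ (by positivity)
      calc (16 * lam + 2) * κ ^ 2 ≤ (16 * lam + 2) ^ 2 * κ ^ 2 :=
            mul_le_mul_of_nonneg_right (by nlinarith) (sq_nonneg _)
        _ = ((16 * lam + 2) * κ) ^ 2 := by ring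
        _ ≤ C ^ 2 := pow_le_pow_left₀ (by positivity) (by linarith) 2
    · refine mul_le_mul' ?_ (lintegral_mono_set (Ioo_min_subset hT₀ T₁ r))
      rw [← ENNReal.ofReal_pow (by positivity)]
      refine ENNReal.ofReal_le_ofReal ?_
      have : 8 ≤ C := by rw [hC]; linarith [mul_pos (by linarith : 0 < 16 * lam + 2) hκ]
      nlinarith
  have hsqrt : ∀ x y : ℝ≥0∞, (x ^ 2 * y) ^ (1 / 2 : ℝ) = x * y ^ (1 / 2 : ℝ) := by
    intro x y
    rw [ENNReal.mul_rpow_of_nonneg _ _ (by norm_num), ← ENNReal.rpow_natCast, ← ENNReal.rpow_mul]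
    norm_num
  calc X ^ (1 / 2 : ℝ) ≤ ((ENNReal.ofReal C * ENNReal.ofReal r⁻¹) ^ 2 * Y +
        ENNReal.ofReal C ^ 2 * Z) ^ (1 / 2 : ℝ) := ENNReal.rpow_le_rpow hXYZ (by norm_num)
    _ ≤ _ := ENNReal.rpow_add_le_add_rpow _ _ (by norm_num) (by norm_num)
    _ = _ := by rw [hsqrt, hsqrt, mul_add, mul_assoc]

end
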